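/- Let $G$ be a countable (simple, undirected, not necessarily connected) graph, regarded as a 1-complex in which each edge is a copy of $[0,1]$. For edge lengths $\ell : E(G)\to\mathbb R_{>0}$, let $d_\ell(x,y)$ be the infimum of the lengths of all arcs from $x$ to $y$ in $G$ (equivalently, of all finite concatenations of segments of edges leading from $x$ to $y$), where an edge $e$ has length $\ell(e)$, and $d_\ell(x,y)=\infty$ if there is no such arc. Let $|G|_\ell$ be the completion of the (extended) metric space obtained from $(G,d_\ell)$ by identifying points at distance $0$. A ray is a one-way infinite path; two rays are equivalent if no finite set of vertices separates them; the classes are the vertex-ends of $G$. For a finite $S\subseteq V(G)$ and a vertex-end $\omega$, let $C(S,\omega)$ be the component of $G-S$ that contains a ray of $\omega$. Let $\mathrm{MTOP}(G)$ be the set of all points of $G$ and all vertex-ends of $G$, with the topology generated by: the open sets of inner points of single edges; the open stars of radius $\varepsilon$, $0<\varepsilon<1$, around vertices; and, for all finite $S\subseteq V(G)$, all vertex-ends $\omega$ and all $\varepsilon>0$, the sets consisting of $C(S,\omega)$, all vertex-ends with a ray in $C(S,\omega)$, and all inner points of edges between $S$ and $C(S,\omega)$ at distance less than $\varepsilon$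 (in the edge as a copy of $[0,1]$) from their endvertex in $C(S,\omega)$. Write $|G|_\ell\approx \mathrm{MTOP}(G)$ if the identity on $G$ extends to a homeomorphism $|G|_\ell\to \mathrm{MTOP}(G)$. (1) Let $v_1,v_2,\dots$ be a (finite or infinite) enumeration of the vertices of $G$, let $\ell_i=\ell(v_i)>0$ be real numbers with $\sum_i \ell_i<\infty$, and let $\ell'(v_iv_j)=\tfrac12(\ell_i+\ell_j)$ for every edge $v_iv_j$ of $G$. Then $|G|_{\ell'}\approx \mathrm{MTOP}(G)$. (2) In particular, let $L(G)$ be the line graph of $G$, let $\ell:E(G)\to\mathbb R_{>0}$ satisfy $\sum_{e\in E(G)}\ell(e)<\infty$, and let $\ell_L(f)=\tfrac12(\ell(e)+\ell(d))$ for every edge $f$ of $L(G)$ joining $e,d\in E(G)$. Then $|L(G)|_{\ell_L}\approx \mathrm{MTOP}(L(G))$. -/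

import Mathlib

open scoped ENNReal

namespace GraphTop

universe u

variable {V : Type u}

/-! ### The graph as a 1-complex -/

/-- The underlying set of the 1-complex of a graph, in barycentric coordinates: its points are the
vertices `v`, and the points `(1 - t) u + t v` (`0 ≤ t ≤ 1`) of the edges `uv`. -/
def Point (G : SimpleGraph V) : Type u :=
  {x : V →₀ ℝ // (∃ v, x = Finsupp.single v 1) ∨
    ∃ u v, G.Adj u v ∧ ∃ t : unitInterval,
      x = Finsupp.single u (1 - (t : ℝ)) + Finsupp.single v (t : ℝ)}

/-- A vertex as a point of the 1-complex. -/
noncomputable def vtx (G : SimpleGraph V) (v : V) : Point G :=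
  ⟨Finsupp.single v 1, Or.inl ⟨v, rfl⟩⟩

/-- The point of the edge `uv` at distance `t` from `u`, the edge being a copy of `[0, 1]`. -/
noncomputable def edgePt {G : SimpleGraph V} {u v : V} (h : G.Adj u v) (t : unitInterval) :
    Point G :=
  ⟨Finsupp.single u (1 - (t : ℝ)) + Finsupp.single v (t : ℝ), Or.inr ⟨u, v, h, t, rfl⟩⟩

/-! ### The distance induced by edge lengths, and its completion -/

/-- `Route ℓ x y r`: there is a polygonal path of length `r` from `x` to `y`, i.e. a finite
concatenation of (straight) segments of edges, where the edge `e` is a copy of `[0, ℓ e]`. -/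
inductive Route {G : SimpleGraph V} (ℓ : G.edgeSet → ℝ) : Point G → Point G → ℝ → Prop
  | refl (x : Point G) : Route ℓ x x 0
  | cons {u v : V} (h : G.Adj u v) (s t : unitInterval) {y : Point G} {r : ℝ} :
      Route ℓ (edgePt h t) y r →
        Route ℓ (edgePt h s) y (ℓ ⟨s(u, v), h⟩ * |(s : ℝ) - (t : ℝ)| + r)

theorem Route.trans {G : SimpleGraph V} {ℓ : G.edgeSet → ℝ} {x y z : Point G} {r r' : ℝ}
    (h₁ : Route ℓ x y r) (h₂ : Route ℓ y z r') : Route ℓ x z (r + r') := by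
  induction h₁ with
  | refl x => simpa using h₂
  | cons h s t _ ih => rw [add_assoc]; exact .cons h s t (ih h₂)

theorem Route.symm {G : SimpleGraph V} {ℓ : G.edgeSet → ℝ} {x y : Point G} {r : ℝ}
    (h₁ : Route ℓ x y r) : Route ℓ y x r := by
  induction h₁ with
  | refl x => exact .refl x
  | cons h s t _ ih =>
    have := ih.trans (.cons h t s (.refl _))
    rwa [add_zero, add_comm, abs_sub_comm] at this

/-- The points of the 1-complex of `G`, with the distance induced by the edge lengths `ℓ`. -/
def LPoint {G : SimpleGraph V} (_ℓ : G.edgeSet → ℝ) : Type u := Point G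

/-- The distance `d_ℓ`: the infimum of the lengths of all polygonal paths from `x` to `y`
(equivalently, of all arcs from `x` to `y`: every arc of the 1-complex is polygonal, and every
polygonal path contains an arc with the same endpoints). It is `∞` for points in different
components, and it may vanish for distinct points. -/
noncomputable instance {G : SimpleGraph V} (ℓ : G.edgeSet → ℝ) : PseudoEMetricSpace (LPoint ℓ) where
  edist x y := ⨅ (r : ℝ) (_ : Route ℓ x y r), ENNReal.ofReal r
  edist_self x := by
    refine le_antisymm (iInf₂_le_of_le 0 (Route.refl x) (by simp)) zero_le
  edist_comm x y := le_antisymm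
    (le_iInf₂ fun r h => iInf₂_le_of_le r h.symm le_rfl)
    (le_iInf₂ fun r h => iInf₂_le_of_le r h.symm le_rfl)
  edist_triangle x y z := by
    simp only [ENNReal.iInf_add, ENNReal.add_iInf]
    refine le_iInf fun r => le_iInf fun h => le_iInf fun r' => le_iInf fun h' => ?_
    exact iInf₂_le_of_le (r' + r) (h'.trans h) ENNReal.ofReal_add_le

/-- The space `|G|_ℓ`: identify points at distance `0`, and take the completion. -/
abbrev LTop {G : SimpleGraph V} (ℓ : G.edgeSet → ℝ) : Type u :=
  UniformSpace.Completion (SeparationQuotient (LPoint ℓ))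

/-- The canonical map from the 1-complex `G` to `|G|_ℓ`. -/
noncomputable def toLTop {G : SimpleGraph V} (ℓ : G.edgeSet → ℝ) (x : Point G) : LTop ℓ :=
  ((SeparationQuotient.mk (X := LPoint ℓ) x : SeparationQuotient (LPoint ℓ)) : LTop ℓ)

/-! ### Vertex-ends -/

/-- A ray: a one-way infinite path. -/
structure Ray (G : SimpleGraph V) where
  toFun : ℕ → V
  injective : Function.Injective toFun
  adj : ∀ n, G.Adj (toFun n) (toFun (n + 1))

/-- `u` and `v` are joined by a path of `G - S`. -/
def Joined (G : SimpleGraph V) (S : Finset V) (u v : V) : Prop :=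
  ∃ p : G.Walk u v, ∀ x ∈ p.support, x ∉ S

/-- Two rays are vertex-equivalent if no finite set of vertices separates them. -/
def Ray.Equivalent {G : SimpleGraph V} (R L : Ray G) : Prop :=
  ∀ S : Finset V, ∃ i j, Joined G S (R.toFun i) (L.toFun j)

theorem Joined.symm {G : SimpleGraph V} {S : Finset V} {u v : V} (h : Joined G S u v) :
    Joined G S v u := by
  obtain ⟨p, hp⟩ := h
  exact ⟨p.reverse, by simpa using hp⟩

theorem Joined.trans {G : SimpleGraph V} {S : Finset V} {u v w : V} (h : Joined G S u v)
    (h' : Joined G S v w) : Joined G S u w := by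
  obtain ⟨p, hp⟩ := h
  obtain ⟨q, hq⟩ := h'
  refine ⟨p.append q, fun x hx => ?_⟩
  rcases (SimpleGraph.Walk.mem_support_append_iff p q).1 hx with hx | hx
  exacts [hp x hx, hq x hx]

theorem Joined.mono {G : SimpleGraph V} {S T : Finset V} {u v : V} (h : Joined G T u v)
    (hST : S ⊆ T) : Joined G S u v := by
  obtain ⟨p, hp⟩ := h
  exact ⟨p, fun x hx hS => hp x hx (hST hS)⟩

theorem Ray.exists_forall_notMem {G : SimpleGraph V} (R : Ray G) (S : Finset V) :
    ∃ n, ∀ i ≥ n, R.toFun i ∉ S := by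
  have hf : (R.toFun ⁻¹' (S : Set V)).Finite :=
    S.finite_toSet.preimage R.injective.injOn
  obtain ⟨n, hn⟩ := hf.bddAbove
  refine ⟨n + 1, fun i hi hS => ?_⟩
  have : i ≤ n := hn hS
  omega

theorem Ray.joined_tail {G : SimpleGraph V} (R : Ray G) {S : Finset V} {n : ℕ}
    (hn : ∀ i ≥ n, R.toFun i ∉ S) {i : ℕ} (hi : n ≤ i) :
    Joined G S (R.toFun n) (R.toFun i) := by
  induction i, hi using Nat.le_induction with
  | base => exact ⟨.nil, by simpa using hn n le_rfl⟩
  | succ i hi ih =>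
    refine ih.trans ⟨(R.adj i).toWalk, ?_⟩
    have h1 := hn i hi
    have h2 := hn (i + 1) (by omega)
    simp [h1, h2]

theorem Ray.Equivalent.trans {G : SimpleGraph V} {R L M : Ray G} (h : R.Equivalent L)
    (h' : L.Equivalent M) : R.Equivalent M := by
  classical
  intro S
  obtain ⟨n, hn⟩ := L.exists_forall_notMem S
  set T : Finset V := S ∪ (Finset.range n).image L.toFun with hT
  have hST : S ⊆ T := Finset.subset_union_left
  have key : ∀ j, L.toFun j ∉ T → n ≤ j := by
    intro j hj
    by_contra hlt
    exact hj (Finset.mem_union_right _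
      (Finset.mem_image_of_mem _ (Finset.mem_range.2 (not_le.1 hlt))))
  obtain ⟨i, j, hp⟩ := h T
  obtain ⟨j', k, hq⟩ := h' T
  have hj : n ≤ j := key j (by obtain ⟨p, hp⟩ := hp; exact hp _ p.end_mem_support)
  have hj' : n ≤ j' := key j' (by obtain ⟨q, hq⟩ := hq; exact hq _ q.start_mem_support)
  exact ⟨i, k, ((hp.mono hST).trans ((L.joined_tail hn hj).symm.trans
    (L.joined_tail hn hj'))).trans (hq.mono hST)⟩

/-- Vertex-equivalence of rays. -/
def raySetoid (G : SimpleGraph V) : Setoid (Ray G) where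
  r := Ray.Equivalent
  iseqv :=
    { refl := fun R S => by
        obtain ⟨n, hn⟩ := R.exists_forall_notMem S
        exact ⟨n, n, R.joined_tail hn le_rfl⟩
      symm := fun h S => by
        obtain ⟨i, j, hp⟩ := h S
        exact ⟨j, i, hp.symm⟩
      trans := Ray.Equivalent.trans }

/-- The set `Ω(G)` of vertex-ends of `G`. -/
def VertexEnd (G : SimpleGraph V) : Type u := Quotient (raySetoid G)

/-- `R` is an `ω`-ray. -/
def Ray.BelongsTo {G : SimpleGraph V} (R : Ray G) (ω : VertexEnd G) : Prop :=
  Quotient.mk (raySetoid G) R = ω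

/-! ### The topology `MTOP` -/

/-- The points of `MTOP(G)`: those of the 1-complex `G`, and the vertex-ends of `G`. -/
inductive MTop (G : SimpleGraph V) : Type u
  | point (x : Point G) : MTop G
  | vend (ω : VertexEnd G) : MTop G

/-- The set of vertices of `C(S, ω)`, the component of `G - S` that contains an `ω`-ray. -/
def compVerts (G : SimpleGraph V) (S : Finset V) (ω : VertexEnd G) : Set V :=
  {v | ∃ R : Ray G, R.BelongsTo ω ∧ (∀ n, R.toFun n ∉ S) ∧ Joined G S v (R.toFun 0)}

/-- The set of inner points of the edge `uv` whose distance from `u` lies in `U`. -/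
def edgeSub {G : SimpleGraph V} {u v : V} (h : G.Adj u v) (U : Set unitInterval) : Set (MTop G) :=
  {p | ∃ t ∈ U, 0 < t ∧ t < 1 ∧ p = .point (edgePt h t)}

/-- The open star of radius `ε` around the vertex `v`. -/
def openStar (G : SimpleGraph V) (v : V) (ε : ℝ) : Set (MTop G) :=
  {p | p = .point (vtx G v) ∨
    ∃ (w : V) (h : G.Adj v w) (t : unitInterval), (t : ℝ) < ε ∧ p = .point (edgePt h t)}

/-- The basic open set `Ĉ_ε(S, ω)`: the component `C = C(S, ω)` of `G - S` (its vertices and the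
points of its edges), the ends that have a ray in `C`, and the inner points of `S`-`C` edges at
distance less than `ε` from their endpoint in `C`. -/
def endNhd (G : SimpleGraph V) (S : Finset V) (ω : VertexEnd G) (ε : ℝ) : Set (MTop G) :=
  {p | (∃ v ∈ compVerts G S ω, p = .point (vtx G v)) ∨
    (∃ u ∈ compVerts G S ω, ∃ v ∈ compVerts G S ω, ∃ (h : G.Adj u v) (t : unitInterval),
      p = .point (edgePt h t)) ∨
    (∃ (ω' : VertexEnd G) (R : Ray G), R.BelongsTo ω' ∧ (∀ n, R.toFun n ∈ compVerts G S ω) ∧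
      p = .vend ω') ∨
    (∃ u ∈ compVerts G S ω, ∃ v ∈ S, ∃ (h : G.Adj u v) (t : unitInterval),
      0 < t ∧ t < 1 ∧ (t : ℝ) < ε ∧ p = .point (edgePt h t))}

/-- The topology of `MTOP(G)`, generated by the open sets of inner points of edges, the open stars
around vertices, and the sets `Ĉ_ε(S, ω)`. -/
instance (G : SimpleGraph V) : TopologicalSpace (MTop G) :=
  TopologicalSpace.generateFrom
    ({A | ∃ (u v : V) (h : G.Adj u v) (U : Set unitInterval), IsOpen U ∧ A = edgeSub h U} ∪
      {A | ∃ (v : V) (ε : ℝ), 0 < ε ∧ ε < 1 ∧ A = openStar G v ε} ∪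
      {A | ∃ (S : Finset V) (ω : VertexEnd G) (ε : ℝ), 0 < ε ∧ A = endNhd G S ω ε})

/-! ### The comparison -/

/-- `|G|_ℓ ≈ MTOP(G)`: the identity on `G` extends to a homeomorphism between these spaces. -/
def LTopApproxMTop {G : SimpleGraph V} (ℓ : G.edgeSet → ℝ) : Prop :=
  ∃ h : LTop ℓ ≃ₜ MTop G, ∀ x : Point G, h (toLTop ℓ x) = .point x

/-- The edge lengths `(w u + w v) / 2` of the edges `uv`, for a weight `w` on the vertices. -/
noncomputable def meanLength (G : SimpleGraph V) (w : V → ℝ) (e : G.edgeSet) : ℝ :=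
  Sym2.lift ⟨fun u v => (w u + w v) / 2, fun u v => by simp only [add_comm]⟩ (e : Sym2 V)

end GraphTop

/-!
In barycentric coordinates, a set `A` of vertices has a mass at each point of `G`: the total weight
of the vertices in `A`. If only finitely many vertices are needed to cover the edge boundary of `A`,
and the edge lengths at each vertex are bounded above and away from zero, then the mass of `A` is
Lipschitz for `d_ℓ`, and hence extends continuously to `|G|_ℓ`. This applies to single vertices and
to the components of `G - S` for finite `S`, and the basic open sets of `MTOP(G)` are cut out by
open conditions on these masses.

Suppose that, in addition, the components of `G - S` become uniformly small for `d_ℓ` as the finite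
set `S` grows. Then the rays of an end `ω` converge in `|G|_ℓ`, to the unique point at which every
component `C(S, ω)` has mass `1`. Sending `ω` to this point extends the canonical map from `G` to a
map `MTOP(G) → |G|_ℓ`, which is inducing and injective because masses describe both topologies and
separate points. It is surjective: a point of `|G|_ℓ` that gives positive mass to some vertex lies
on an edge at this vertex, because edges are compact; and a point at which every vertex has mass
`0` gives, for each `S`, mass `1` to exactly one component of `G - S`, and these components
determine an end, since `G` is countable.

For `ℓ(uv) = (w u + w v) / 2` with `w` summable, a path avoiding `S` has length at most the sum of
`w` over its vertices, which is small once the tail of `w` outside `S` is small.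
-/

namespace GraphTop

variable {V : Type*} {G : SimpleGraph V}

/-! ### Barycentric weights -/

theorem edgePt_zero {u v : V} (h : G.Adj u v) : edgePt h 0 = vtx G u :=
  Subtype.ext (by simp [edgePt, vtx])

theorem edgePt_one {u v : V} (h : G.Adj u v) : edgePt h 1 = vtx G v :=
  Subtype.ext (by simp [edgePt, vtx])

theorem edgePt_symm {u v : V} (h : G.Adj u v) (t : unitInterval) :
    edgePt h.symm (unitInterval.symm t) = edgePt h t :=
  Subtype.ext (by simp [edgePt, add_comm])

theorem Point.eq_vtx_or_edgePt (x : Point G) :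
    (∃ v, x = vtx G v) ∨ ∃ (u v : V) (h : G.Adj u v) (t : unitInterval), x = edgePt h t := by
  obtain ⟨x, ⟨v, rfl⟩ | ⟨u, v, h, t, rfl⟩⟩ := x
  exacts [.inl ⟨v, rfl⟩, .inr ⟨u, v, h, t, rfl⟩]

/-- The total barycentric weight of the vertices in `A` at the point `x`. -/
noncomputable def mass (A : Set V) (x : Point G) : ℝ :=
  Finsupp.linearCombination ℝ (A.indicator (1 : V → ℝ)) x.1

theorem mass_vtx (A : Set V) (v : V) : mass A (vtx G v) = A.indicator 1 v := by
  simp [mass, vtx]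

theorem mass_edgePt (A : Set V) {u v : V} (h : G.Adj u v) (t : unitInterval) :
    mass A (edgePt h t) = (1 - (t : ℝ)) * A.indicator 1 u + t * A.indicator 1 v := by
  simp [mass, edgePt, sub_mul]

theorem mass_eq_sum (A : Set V) (x : Point G) :
    mass A x = ∑ v ∈ x.1.support, A.indicator x.1 v := by
  classical
  simp [mass, Finsupp.linearCombination_apply, Finsupp.sum, Set.indicator_apply]

theorem mass_univ (x : Point G) : mass Set.univ x = 1 := by
  obtain ⟨v, rfl⟩ | ⟨u, v, h, t, rfl⟩ := x.eq_vtx_or_edgePt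
  · simp [mass_vtx]
  · simp [mass_edgePt]

theorem mass_union {A B : Set V} (hAB : Disjoint A B) (x : Point G) :
    mass (A ∪ B) x = mass A x + mass B x := by
  simp only [mass_eq_sum, Set.indicator_union_of_disjoint hAB, Finset.sum_add_distrib]

theorem mass_singleton (v : V) (x : Point G) : mass {v} x = x.1 v := by
  classical
  simp [mass_eq_sum, Set.indicator_apply, eq_comm]

theorem mass_coe_finset (S : Finset V) (x : Point G) : mass S x = ∑ v ∈ S, mass {v} x := by
  classical
  induction S using Finset.induction_on with
  | empty => simp [mass_eq_sum]
  | insert v S hv ih =>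
    rw [Finset.coe_insert, Set.insert_eq, mass_union (by simpa using hv), ih, Finset.sum_insert hv]

theorem Point.ext_mass {x y : Point G} (h : ∀ v, mass {v} x = mass {v} y) : x = y :=
  Subtype.ext (Finsupp.ext fun v => by simpa only [mass_singleton] using h v)

theorem Point.coe_nonneg (x : Point G) (v : V) : 0 ≤ x.1 v := by
  rw [← mass_singleton]
  obtain ⟨w, rfl⟩ | ⟨w, w', h, t, rfl⟩ := x.eq_vtx_or_edgePt
  · exact (mass_vtx _ _).symm ▸ Set.indicator_nonneg (fun _ _ => zero_le_one) w
  · rw [mass_edgePt]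
    have h₁ : (0 : ℝ) ≤ 1 - t := sub_nonneg.2 t.2.2
    have h₀ : (0 : ℝ) ≤ t := t.2.1
    have hind : ∀ u, 0 ≤ Set.indicator {v} (1 : V → ℝ) u :=
      Set.indicator_nonneg fun _ _ => zero_le_one
    exact add_nonneg (mul_nonneg h₁ (hind w)) (mul_nonneg h₀ (hind w'))

theorem mass_nonneg (A : Set V) (x : Point G) : 0 ≤ mass A x := by
  rw [mass_eq_sum]
  exact Finset.sum_nonneg fun v _ => Set.indicator_nonneg (fun v _ => x.coe_nonneg v) v

theorem mass_mono {A B : Set V} (hAB : A ⊆ B) (x : Point G) : mass A x ≤ mass B x := by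
  rw [← Set.union_sdiff_cancel hAB, mass_union Set.disjoint_sdiff_right]
  exact le_add_of_nonneg_right (mass_nonneg _ x)

theorem mass_compl_add (A : Set V) (x : Point G) : mass Aᶜ x + mass A x = 1 := by
  rw [← mass_union disjoint_compl_left, Set.compl_union_self, mass_univ]

theorem mass_le_one (A : Set V) (x : Point G) : mass A x ≤ 1 :=
  (mass_mono (Set.subset_univ A) x).trans_eq (mass_univ x)

theorem mass_pos_iff {A : Set V} {x : Point G} : 0 < mass A x ↔ ∃ a ∈ A, 0 < mass {a} x := by
  refine ⟨fun h => ?_, fun ⟨a, ha, h⟩ => h.trans_le (mass_mono (Set.singleton_subset_iff.2 ha) x)⟩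
  rw [mass_eq_sum] at h
  obtain ⟨a, -, h⟩ := Finset.exists_lt_of_sum_lt ((Finset.sum_const_zero (ι := V)).trans_lt h)
  have ha : a ∈ A := Set.mem_of_indicator_ne_zero h.ne'
  exact ⟨a, ha, by rwa [mass_singleton, ← Set.indicator_of_mem ha x.1]⟩

theorem exists_mass_singleton_pos (x : Point G) : ∃ v, 0 < mass {v} x := by
  obtain ⟨v, -, hv⟩ := mass_pos_iff.1 ((mass_univ x).symm ▸ one_pos)
  exact ⟨v, hv⟩

theorem eq_vtx_or_edgePt_of_pos {v : V} {x : Point G} (hv : 0 < mass {v} x) :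
    x = vtx G v ∨ ∃ (u : V) (h : G.Adj v u) (t : unitInterval), x = edgePt h t := by
  obtain ⟨a, rfl⟩ | ⟨a, b, h, t, rfl⟩ := x.eq_vtx_or_edgePt
  · rw [mass_vtx] at hv
    exact .inl (congrArg _ (Set.mem_singleton_iff.1 (Set.mem_of_indicator_ne_zero hv.ne')))
  · obtain rfl | hav := eq_or_ne a v
    · exact .inr ⟨b, h, t, rfl⟩
    obtain rfl | hbv := eq_or_ne b v
    · exact .inr ⟨a, h.symm, _, (edgePt_symm h t).symm⟩
    · simp [mass_edgePt, hav, hbv] at hv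

theorem eq_edgePt_of_pos {u v : V} (huv : u ≠ v) {x : Point G} (hu : 0 < mass {u} x)
    (hv : 0 < mass {v} x) :
    ∃ (h : G.Adj u v) (t : unitInterval), 0 < t ∧ t < 1 ∧ x = edgePt h t := by
  obtain rfl | ⟨w, h, t, rfl⟩ := eq_vtx_or_edgePt_of_pos hu
  · simp [mass_vtx, huv] at hv
  obtain rfl : w = v := by
    by_contra hwv
    simp [mass_edgePt, huv, hwv] at hv
  simp only [mass_edgePt, Set.mem_singleton_iff, huv, huv.symm, not_false_eq_true,
    Set.indicator_of_mem, Set.indicator_of_notMem, Pi.one_apply, mul_zero, mul_one, add_zero,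
    zero_add, sub_pos] at hu hv
  exact ⟨h, t, hv, hu, rfl⟩

/-! ### Lipschitz functions on the 1-complex and their extensions -/

section Extension

open UniformSpace Topology Filter Uniformity
open scoped NNReal

variable {ℓ : G.edgeSet → ℝ} {S : Finset V} {A B : Set V}

theorem exists_forall_edist_extend_le {α β γ : Type*}
    [PseudoEMetricSpace α] [UniformSpace β] [EMetricSpace γ] [CompleteSpace γ] {i : α → β}
    (hi : IsUniformInducing i) (hd : DenseRange i) (K : ℝ≥0) (z : β) {ε : ℝ≥0∞} (hε : ε ≠ 0) :
    ∃ x, ∀ f : α → γ, LipschitzWith K f →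
      edist ((hi.isDenseInducing hd).extend f z) (f x) ≤ ε := by
  have := (hi.isDenseInducing hd).comap_nhds_neBot z
  have hF : Cauchy (comap i (𝓝 z)) := cauchy_nhds.comap' hi.comap_uniformity.le this
  obtain ⟨T, hT, hTsmall⟩ :=
    (EMetric.cauchy_iff.1 hF).2 (ε / K) (ENNReal.div_pos hε ENNReal.coe_ne_top)
  obtain ⟨x, hx⟩ := nonempty_of_mem hT
  refine ⟨x, fun f hf => ?_⟩
  have hlim : Tendsto f (comap i (𝓝 z)) (𝓝 ((hi.isDenseInducing hd).extend f z)) :=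
    uniformly_extend_spec hi hd hf.uniformContinuous z
  refine le_of_tendsto (hlim.edist tendsto_const_nhds) ?_
  filter_upwards [hT] with y hy
  exact (hf y x).trans (ENNReal.mul_le_of_le_div' (hTsmall y hy x hx).le)

/-- At each vertex, the edge lengths are bounded above, and bounded away from zero. -/
def LocallyBounded (ℓ : G.edgeSet → ℝ) : Prop :=
  ∀ v, ∃ K > 0, ∀ u (h : G.Adj v u), ℓ ⟨s(v, u), h⟩ ∈ Set.Icc K⁻¹ K

theorem edge_swap {u v : V} (h : G.Adj u v) :
    (⟨s(v, u), h.symm⟩ : G.edgeSet) = ⟨s(u, v), h⟩ :=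
  Subtype.ext Sym2.eq_swap

theorem LocallyBounded.pos (hℓ : LocallyBounded ℓ) {u v : V} (h : G.Adj u v) :
    0 < ℓ ⟨s(u, v), h⟩ :=
  have ⟨_, hK, hKℓ⟩ := hℓ u
  (inv_pos.2 hK).trans_le (hKℓ v h).1

theorem LocallyBounded.exists_forall_mem (hℓ : LocallyBounded ℓ) (S : Finset V) :
    ∃ K > 0, ∀ v ∈ S, ∀ u (h : G.Adj v u), ℓ ⟨s(v, u), h⟩ ∈ Set.Icc K⁻¹ K := by
  choose K hK hKℓ using hℓ
  have hle : ∀ v ∈ S, K v ≤ 1 + ∑ w ∈ S, K w := fun v hv =>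
    (Finset.single_le_sum (fun w _ => (hK w).le) hv).trans (le_add_of_nonneg_left zero_le_one)
  refine ⟨1 + ∑ w ∈ S, K w, ?_, fun v hv u h => ?_⟩
  · linarith [Finset.sum_nonneg fun w (_ : w ∈ S) => (hK w).le]
  · exact Set.Icc_subset_Icc (inv_anti₀ (hK v) (hle v hv)) (hle v hv) (hKℓ v u h)

/-- On each edge, regarded as a copy of `[0, 1]`, the function `f` is Lipschitz with constant `1`,
and it is constant on the edges without an end in `S`. -/
structure EdgeLipschitz (S : Finset V) (f : Point G → ℝ) : Prop where
  abs_sub_le {u v : V} (h : G.Adj u v) (s t : unitInterval) :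
    |f (edgePt h s) - f (edgePt h t)| ≤ |(s : ℝ) - t|
  eq_of_notMem {u v : V} (h : G.Adj u v) (hu : u ∉ S) (hv : v ∉ S) (s t : unitInterval) :
    f (edgePt h s) = f (edgePt h t)

theorem Route.abs_sub_le {K : ℝ} {f : Point G → ℝ}
    (hf : ∀ u v (h : G.Adj u v) (s t : unitInterval),
      |f (edgePt h s) - f (edgePt h t)| ≤ K * (ℓ ⟨s(u, v), h⟩ * |(s : ℝ) - t|))
    {x y : Point G} {r : ℝ} (h : Route ℓ x y r) : |f x - f y| ≤ K * r := by
  induction h with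
  | refl x => simp
  | @cons u v h s t y r _ ih =>
    rw [mul_add]
    exact (_root_.abs_sub_le _ (f (edgePt h t)) _).trans (add_le_add (hf u v h s t) ih)

theorem lipschitzWith_of_route {K : ℝ≥0} (hK : K ≠ 0) {f : Point G → ℝ}
    (hf : ∀ x y r, Route ℓ x y r → |f x - f y| ≤ K * r) :
    LipschitzWith (α := LPoint ℓ) K f := by
  intro x y
  change _ ≤ (K : ℝ≥0∞) * ⨅ (r : ℝ) (_ : Route ℓ x y r), ENNReal.ofReal r
  simp only [ENNReal.mul_iInf_of_ne (ENNReal.coe_ne_zero.2 hK) ENNReal.coe_ne_top]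
  refine le_iInf₂ fun r hr => ?_
  calc edist (f x) (f y) = ENNReal.ofReal |f x - f y| := by rw [edist_dist, Real.dist_eq]
    _ ≤ ENNReal.ofReal (K * r) := ENNReal.ofReal_le_ofReal (hf x y r hr)
    _ = K * ENNReal.ofReal r := by rw [ENNReal.ofReal_mul K.coe_nonneg, ENNReal.ofReal_coe_nnreal]

theorem LocallyBounded.exists_lipschitzWith (hℓ : LocallyBounded ℓ) (S : Finset V) :
    ∃ K : ℝ≥0, ∀ f, EdgeLipschitz S f → LipschitzWith (α := LPoint ℓ) K f := by
  obtain ⟨K, hK, hKℓ⟩ := hℓ.exists_forall_mem S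
  have one_le : ∀ {u v : V} (h : G.Adj u v), u ∈ S → 1 ≤ K * ℓ ⟨s(u, v), h⟩ := fun h hu =>
    (mul_inv_cancel₀ hK.ne').symm.trans_le (mul_le_mul_of_nonneg_left (hKℓ _ hu _ h).1 hK.le)
  refine ⟨⟨K, hK.le⟩, fun f hf => lipschitzWith_of_route (ne_of_gt hK)
    fun x y r => Route.abs_sub_le fun u v h s t => ?_⟩
  by_cases hS : u ∈ S ∨ v ∈ S
  · have : 1 ≤ K * ℓ ⟨s(u, v), h⟩ :=
      hS.elim (one_le h) fun hv => edge_swap h ▸ one_le h.symm hv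
    rw [← mul_assoc]
    exact (hf.abs_sub_le h s t).trans (le_mul_of_one_le_left (abs_nonneg _) this)
  · push Not at hS
    rw [hf.eq_of_notMem h hS.1 hS.2 s t, sub_self, abs_zero]
    exact mul_nonneg hK.le (mul_nonneg (hℓ.pos h).le (abs_nonneg _))

theorem isUniformInducing_toLTop (ℓ : G.edgeSet → ℝ) :
    IsUniformInducing (α := LPoint ℓ) (toLTop ℓ) :=
  (Completion.isUniformInducing_coe _).comp SeparationQuotient.isUniformInducing_mk

theorem denseRange_toLTop (ℓ : G.edgeSet → ℝ) : DenseRange (α := LPoint ℓ) (toLTop ℓ) :=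
  Completion.denseRange_coe.comp SeparationQuotient.surjective_mk.denseRange
    (Completion.continuous_coe _)

theorem isDenseInducing_toLTop (ℓ : G.edgeSet → ℝ) :
    IsDenseInducing (α := LPoint ℓ) (toLTop ℓ) :=
  (isUniformInducing_toLTop ℓ).isDenseInducing (denseRange_toLTop ℓ)

/-- The extension by continuity to `|G|_ℓ` of a function on the 1-complex. -/
noncomputable def extL (ℓ : G.edgeSet → ℝ) (f : Point G → ℝ) : LTop ℓ → ℝ :=
  (isDenseInducing_toLTop ℓ).extend f

theorem EdgeLipschitz.uniformContinuous {f : Point G → ℝ} (hf : EdgeLipschitz S f)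
    (hℓ : LocallyBounded ℓ) : UniformContinuous (α := LPoint ℓ) f :=
  have ⟨_, hK⟩ := hℓ.exists_lipschitzWith S
  (hK f hf).uniformContinuous

theorem EdgeLipschitz.extL_toLTop {f : Point G → ℝ} (hf : EdgeLipschitz S f)
    (hℓ : LocallyBounded ℓ) (x : Point G) : extL ℓ f (toLTop ℓ x) = f x :=
  uniformly_extend_of_ind (isUniformInducing_toLTop ℓ) (denseRange_toLTop ℓ)
    (hf.uniformContinuous hℓ) x

theorem EdgeLipschitz.continuous_extL {f : Point G → ℝ} (hf : EdgeLipschitz S f)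
    (hℓ : LocallyBounded ℓ) : Continuous (extL ℓ f) :=
  (uniformContinuous_uniformly_extend (isUniformInducing_toLTop ℓ) (denseRange_toLTop ℓ)
    (hf.uniformContinuous hℓ)).continuous

theorem exists_point_forall_abs_extL_sub_le (hℓ : LocallyBounded ℓ) (S : Finset V) (z : LTop ℓ)
    {ε : ℝ} (hε : 0 < ε) :
    ∃ x : Point G, ∀ f, EdgeLipschitz S f → |extL ℓ f z - f x| ≤ ε := by
  obtain ⟨K, hKlip⟩ := hℓ.exists_lipschitzWith S
  obtain ⟨x, hx⟩ := exists_forall_edist_extend_le (γ := ℝ) (isUniformInducing_toLTop ℓ)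
    (denseRange_toLTop ℓ) K z (ENNReal.ofReal_pos.2 hε).ne'
  refine ⟨x, fun f hf => ?_⟩
  rw [← ENNReal.ofReal_le_ofReal_iff hε.le, ← Real.dist_eq, ← edist_dist]
  exact hx f (hKlip f hf)

theorem subset_of_forall_toLTop {O F : Set (LTop ℓ)} (hO : IsOpen O) (hF : IsClosed F)
    (h : ∀ x : Point G, toLTop ℓ x ∈ O → toLTop ℓ x ∈ F) : O ⊆ F := by
  refine ((denseRange_toLTop ℓ).open_subset_closure_inter hO).trans (closure_minimal ?_ hF)
  rintro _ ⟨hz, x, rfl⟩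
  exact h x hz

/-! ### Masses on the completion -/

/-- Finitely many vertices cover the edge boundary of `A`. -/
def FiniteBoundary (G : SimpleGraph V) (A : Set V) : Prop :=
  ∃ S : Finset V, ∀ u v, G.Adj u v → u ∈ A → v ∉ A → u ∈ S ∨ v ∈ S

theorem edgeLipschitz_mass
    (hA : ∀ u v, G.Adj u v → u ∈ A → v ∉ A → u ∈ S ∨ v ∈ S) :
    EdgeLipschitz S (mass (G := G) A) where
  abs_sub_le {u v} h s t := by
    rw [mass_edgePt, mass_edgePt]
    by_cases hu : u ∈ A <;> by_cases hv : v ∈ A <;> simp [hu, hv, abs_sub_comm]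
  eq_of_notMem {u v} h hu hv s t := by
    have huv : u ∈ A ↔ v ∈ A :=
      ⟨fun huA => by_contra fun hvA => (hA u v h huA hvA).elim hu hv,
        fun hvA => by_contra fun huA => (hA v u h.symm hvA huA).elim hv hu⟩
    rw [mass_edgePt, mass_edgePt]
    by_cases huA : u ∈ A
    · simp [huA, huv.1 huA]
    · simp [huA, mt huv.2 huA]

theorem finiteBoundary_finset (S : Finset V) : FiniteBoundary G S :=
  ⟨S, fun _ _ _ hu _ => .inl hu⟩

theorem edgeLipschitz_mass_singleton (v : V) : EdgeLipschitz {v} (mass (G := G) {v}) :=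
  edgeLipschitz_mass fun _ _ _ hu _ => .inl (Finset.mem_singleton.2 hu)

theorem finiteBoundary_singleton (v : V) : FiniteBoundary G {v} :=
  Finset.coe_singleton v ▸ finiteBoundary_finset {v}

/-- The extension by continuity to `|G|_ℓ` of the total weight of the vertices in `A`. -/
noncomputable def massL (ℓ : G.edgeSet → ℝ) (A : Set V) : LTop ℓ → ℝ :=
  extL ℓ (mass A)

theorem massL_toLTop (hℓ : LocallyBounded ℓ) (hA : FiniteBoundary G A) (x : Point G) :
    massL ℓ A (toLTop ℓ x) = mass A x :=
  have ⟨_, hS⟩ := hA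
  (edgeLipschitz_mass hS).extL_toLTop hℓ x

theorem continuous_massL (hℓ : LocallyBounded ℓ) (hA : FiniteBoundary G A) :
    Continuous (massL ℓ A) :=
  have ⟨_, hS⟩ := hA
  (edgeLipschitz_mass hS).continuous_extL hℓ

theorem massL_nonneg (hℓ : LocallyBounded ℓ) (hA : FiniteBoundary G A) (z : LTop ℓ) :
    0 ≤ massL ℓ A z :=
  subset_of_forall_toLTop isOpen_univ (isClosed_le continuous_const (continuous_massL hℓ hA))
    (fun x _ => (mass_nonneg A x).trans_eq (massL_toLTop hℓ hA x).symm) trivial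

theorem massL_le_one (hℓ : LocallyBounded ℓ) (hA : FiniteBoundary G A) (z : LTop ℓ) :
    massL ℓ A z ≤ 1 :=
  subset_of_forall_toLTop isOpen_univ (isClosed_le (continuous_massL hℓ hA) continuous_const)
    (fun x _ => (massL_toLTop hℓ hA x).trans_le (mass_le_one A x)) trivial

theorem massL_add_le_one (hℓ : LocallyBounded ℓ) (hA : FiniteBoundary G A)
    (hB : FiniteBoundary G B) (hAB : Disjoint A B) (z : LTop ℓ) :
    massL ℓ A z + massL ℓ B z ≤ 1 := by
  refine subset_of_forall_toLTop (F := {z | massL ℓ A z + massL ℓ B z ≤ 1}) isOpen_univ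
    (isClosed_le ((continuous_massL hℓ hA).add (continuous_massL hℓ hB)) continuous_const)
    (fun x _ => ?_) (Set.mem_univ z)
  rw [Set.mem_ofPred, massL_toLTop hℓ hA, massL_toLTop hℓ hB, ← mass_union hAB]
  exact mass_le_one _ x

theorem massL_finset (hℓ : LocallyBounded ℓ) (S : Finset V) (z : LTop ℓ) :
    massL ℓ S z = ∑ v ∈ S, massL ℓ {v} z := by
  refine subset_of_forall_toLTop (F := {z | massL ℓ S z = ∑ v ∈ S, massL ℓ {v} z}) isOpen_univ
    (isClosed_eq (continuous_massL hℓ (finiteBoundary_finset S))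
      (continuous_finsetSum S fun v _ => continuous_massL hℓ (finiteBoundary_singleton v)))
    (fun x _ => ?_) (Set.mem_univ z)
  simp only [Set.mem_ofPred, massL_toLTop hℓ (finiteBoundary_finset S),
    massL_toLTop hℓ (finiteBoundary_singleton _)]
  exact mass_coe_finset S x

end Extension

/-! ### Components of `G - S` and ends -/

section Components

variable {S T : Finset V} {C D : Set V}

theorem joined_self {v : V} (h : v ∉ S) : Joined G S v v := ⟨.nil, by simpa using h⟩

theorem joined_of_adj {u v : V} (h : G.Adj u v) (hu : u ∉ S) (hv : v ∉ S) : Joined G S u v :=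
  ⟨h.toWalk, by simp [hu, hv]⟩

theorem Joined.left_notMem {u v : V} (h : Joined G S u v) : u ∉ S :=
  have ⟨p, hp⟩ := h
  hp _ p.start_mem_support

/-- The set `C` is empty or the vertex set of a component of `G - S`. -/
def IsComp (G : SimpleGraph V) (S : Finset V) (C : Set V) : Prop :=
  ∀ u ∈ C, ∀ v, v ∈ C ↔ Joined G S u v

theorem isComp_setOf_joined (G : SimpleGraph V) (S : Finset V) (u : V) :
    IsComp G S {v | Joined G S u v} :=
  fun _ ha _ => ⟨fun hb => ha.symm.trans hb, fun hb => Joined.trans ha hb⟩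

namespace IsComp

theorem notMem (hC : IsComp G S C) {u : V} (hu : u ∈ C) : u ∉ S :=
  ((hC u hu u).1 hu).left_notMem

theorem disjoint_coe (hC : IsComp G S C) : Disjoint C (S : Set V) :=
  Set.disjoint_left.2 fun _ hu => hC.notMem hu

theorem mem_of_adj (hC : IsComp G S C) {u v : V} (hu : u ∈ C) (h : G.Adj u v) (hv : v ∉ S) :
    v ∈ C :=
  (hC u hu v).2 (joined_of_adj h (hC.notMem hu) hv)

theorem subset (hC : IsComp G S C) (hD : IsComp G T D) (hST : S ⊆ T) {u : V} (hu : u ∈ C)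
    (hu' : u ∈ D) : D ⊆ C :=
  fun v hv => (hC u hu v).2 (((hD u hu' v).1 hv).mono hST)

theorem eq (hC : IsComp G S C) (hD : IsComp G S D) {u : V} (hu : u ∈ C) (hu' : u ∈ D) : C = D :=
  (hD.subset hC subset_rfl hu' hu).antisymm (hC.subset hD subset_rfl hu hu')

theorem mem_of_adj_of_notMem (hC : IsComp G S C) {u v : V} (hu : u ∈ C) (h : G.Adj u v)
    (hv : v ∉ C) : v ∈ S :=
  by_contra fun hvS => hv (hC.mem_of_adj hu h hvS)

theorem edgeLipschitz_mass (hC : IsComp G S C) : EdgeLipschitz S (mass (G := G) C) :=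
  GraphTop.edgeLipschitz_mass fun _ _ h hu hv => .inr (hC.mem_of_adj_of_notMem hu h hv)

theorem finiteBoundary (hC : IsComp G S C) : FiniteBoundary G C :=
  ⟨S, fun _ _ h hu hv => .inr (hC.mem_of_adj_of_notMem hu h hv)⟩

theorem exists_walk (hC : IsComp G S C) {u v : V} (hu : u ∈ C) (hv : v ∈ C) :
    ∃ p : G.Walk u v, ∀ x ∈ p.support, x ∈ C := by
  classical
  obtain ⟨p, hp⟩ := (hC u hu v).1 hv
  exact ⟨p, fun x hx => (hC u hu x).2
    ⟨p.takeUntil x hx, fun y hy => hp y (p.support_takeUntil_subset_support hx hy)⟩⟩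

theorem mass_add_eq_one (hC : IsComp G S C) {x : Point G} (hx : 0 < mass C x) :
    mass C x + mass S x = 1 := by
  rw [← mass_union hC.disjoint_coe]
  obtain ⟨u, hu, hux⟩ := mass_pos_iff.1 hx
  obtain rfl | ⟨v, h, t, rfl⟩ := eq_vtx_or_edgePt_of_pos hux
  · simp [mass_vtx, hu]
  · have hv : v ∈ C ∪ S := or_iff_not_imp_right.2 (hC.mem_of_adj hu h)
    simp [mass_edgePt, Set.indicator_of_mem hv, Set.indicator_of_mem (Set.mem_union_left _ hu)]

theorem massL_add_eq_one {ℓ : G.edgeSet → ℝ} (hC : IsComp G S C) (hℓ : LocallyBounded ℓ)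
    {z : LTop ℓ} (hz : 0 < massL ℓ C z) : massL ℓ C z + massL ℓ S z = 1 := by
  have hCc := continuous_massL hℓ hC.finiteBoundary
  have hSc := continuous_massL hℓ (finiteBoundary_finset S)
  refine subset_of_forall_toLTop (O := {z | 0 < massL ℓ C z})
    (F := {z | massL ℓ C z + massL ℓ S z = 1}) (isOpen_lt continuous_const hCc)
    (isClosed_eq (hCc.add hSc) continuous_const) (fun x hx => ?_) hz
  rw [Set.mem_ofPred] at hx ⊢
  rw [massL_toLTop hℓ hC.finiteBoundary] at hx ⊢
  rw [massL_toLTop hℓ (finiteBoundary_finset S)]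
  exact hC.mass_add_eq_one hx

end IsComp

end Components

section Ends

variable {S : Finset V} {R L : Ray G} {ω ω' : VertexEnd G}

/-- The ray obtained by deleting the first `n` vertices. -/
def Ray.drop (R : Ray G) (n : ℕ) : Ray G where
  toFun i := R.toFun (n + i)
  injective _ _ h := by simpa using R.injective h
  adj i := R.adj (n + i)

theorem Ray.drop_equivalent (R : Ray G) (n : ℕ) : (R.drop n).Equivalent R := by
  intro S
  obtain ⟨m, hm⟩ := R.exists_forall_notMem S
  exact ⟨m, n + m, joined_self (hm _ (by omega))⟩

theorem VertexEnd.exists_ray (ω : VertexEnd G) : ∃ R : Ray G, R.BelongsTo ω :=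
  Quotient.exists_rep ω

theorem Ray.BelongsTo.equivalent (hR : R.BelongsTo ω) (hL : L.BelongsTo ω) : R.Equivalent L :=
  Quotient.exact (s := raySetoid G) (hR.trans hL.symm)

theorem Ray.BelongsTo.drop (hR : R.BelongsTo ω) (n : ℕ) : (R.drop n).BelongsTo ω :=
  (Quotient.sound (s := raySetoid G) (R.drop_equivalent n)).trans hR

theorem Ray.Equivalent.joined (h : R.Equivalent L) {m n : ℕ} (hm : ∀ i ≥ m, R.toFun i ∉ S)
    (hn : ∀ i ≥ n, L.toFun i ∉ S) : Joined G S (R.toFun m) (L.toFun n) := by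
  have hdrop : (R.drop m).Equivalent (L.drop n) :=
    ((R.drop_equivalent m).trans h).trans ((raySetoid G).iseqv.symm (L.drop_equivalent n))
  obtain ⟨i, j, hij⟩ := hdrop S
  exact ((R.joined_tail hm (Nat.le_add_right m i)).trans hij).trans
    (L.joined_tail hn (Nat.le_add_right n j)).symm

theorem Ray.BelongsTo.compVerts_eq (hR : R.BelongsTo ω) {n : ℕ} (hn : ∀ i ≥ n, R.toFun i ∉ S) :
    compVerts G S ω = {v | Joined G S (R.toFun n) v} := by
  ext v
  constructor
  · rintro ⟨L, hL, hLS, hv⟩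
    exact ((hR.equivalent hL).joined hn fun i _ => hLS i).trans hv.symm
  · intro hv
    exact ⟨R.drop n, hR.drop n, fun i => hn _ (by omega), Joined.symm hv⟩

theorem isComp_compVerts (G : SimpleGraph V) (S : Finset V) (ω : VertexEnd G) :
    IsComp G S (compVerts G S ω) := by
  obtain ⟨R, hR⟩ := ω.exists_ray
  obtain ⟨n, hn⟩ := R.exists_forall_notMem S
  rw [hR.compVerts_eq hn]
  exact isComp_setOf_joined _ _ _

theorem Ray.BelongsTo.exists_forall_mem (hR : R.BelongsTo ω) (S : Finset V) :
    ∃ n, ∀ i ≥ n, R.toFun i ∈ compVerts G S ω := by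
  obtain ⟨n, hn⟩ := R.exists_forall_notMem S
  rw [hR.compVerts_eq hn]
  exact ⟨n, fun i hi => R.joined_tail hn hi⟩

theorem VertexEnd.ext_compVerts (h : ∀ S, compVerts G S ω = compVerts G S ω') : ω = ω' := by
  obtain ⟨R, rfl⟩ := ω.exists_ray
  obtain ⟨L, rfl⟩ := ω'.exists_ray
  refine Quotient.sound (s := raySetoid G) fun S => ?_
  obtain ⟨m, hm⟩ := Ray.BelongsTo.exists_forall_mem (R := R) rfl S
  obtain ⟨n, hn⟩ := Ray.BelongsTo.exists_forall_mem (R := L) rfl S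
  rw [← h S] at hn
  exact ⟨m, n, (isComp_compVerts G S _ _ (hm m le_rfl) _).1 (hn n le_rfl)⟩

theorem exists_ray_in_compVerts_iff :
    (∃ R : Ray G, R.BelongsTo ω' ∧ ∀ n, R.toFun n ∈ compVerts G S ω) ↔
      compVerts G S ω' = compVerts G S ω := by
  constructor
  · rintro ⟨R, hR, h⟩
    obtain ⟨n, hn⟩ := hR.exists_forall_mem S
    exact (isComp_compVerts G S ω').eq (isComp_compVerts G S ω) (hn n le_rfl) (h n)
  · intro h
    obtain ⟨R, hR⟩ := ω'.exists_ray
    obtain ⟨n, hn⟩ := hR.exists_forall_mem S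
    exact ⟨R.drop n, hR.drop n, fun i => h ▸ hn _ (by omega)⟩

end Ends

/-! ### Small neighbourhoods -/

section Small

open Topology Filter Uniformity

variable {ℓ : G.edgeSet → ℝ} {A : Set V} {r η : ℝ}

theorem exists_pos_forall_open_small {α β : Type*} [PseudoEMetricSpace α] [UniformSpace β]
    {i : α → β} (hi : IsUniformInducing i) (hd : DenseRange i) {W : Set (β × β)}
    (hW : W ∈ 𝓤 β) :
    ∃ r > 0, ∀ O, IsOpen O → (∀ x y, i x ∈ O → i y ∈ O → edist x y ≤ ENNReal.ofReal r) →
      O ×ˢ O ⊆ W := by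
  obtain ⟨T, ⟨hT, hTc⟩, hTW⟩ := uniformity_hasBasis_closed.mem_iff.1 hW
  have hU : Prod.map i i ⁻¹' T ∈ 𝓤 α := hi.comap_uniformity ▸ preimage_mem_comap hT
  obtain ⟨ε, hε, hεT⟩ := mem_uniformity_edist.1 hU
  obtain ⟨r, hr0, hrε⟩ := ENNReal.lt_iff_exists_nnreal_btwn.1 hε
  refine ⟨r, by simpa using hr0, fun O hO hsmall => ?_⟩
  refine (((hd.prodMap hd).open_subset_closure_inter (hO.prod hO)).trans
    (closure_minimal ?_ hTc)).trans hTW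
  rintro _ ⟨hp, p, rfl⟩
  exact hεT ((hsmall _ _ hp.1 hp.2).trans_lt (by simpa using hrε))

/-- The trace of `O` on the 1-complex has diameter at most `r`. -/
def SmallSet (ℓ : G.edgeSet → ℝ) (r : ℝ) (O : Set (LTop ℓ)) : Prop :=
  ∀ x y : Point G, toLTop ℓ x ∈ O → toLTop ℓ y ∈ O →
    edist (α := LPoint ℓ) x y ≤ ENNReal.ofReal r

theorem eq_of_forall_smallSet {z z' : LTop ℓ}
    (h : ∀ r > 0, ∃ O, IsOpen O ∧ SmallSet ℓ r O ∧ z ∈ O ∧ z' ∈ O) : z = z' := by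
  refine eq_of_uniformity fun {W} hW => ?_
  obtain ⟨r, hr, hsmall⟩ :=
    exists_pos_forall_open_small (isUniformInducing_toLTop ℓ) (denseRange_toLTop ℓ) hW
  obtain ⟨O, hO, hOr, hz, hz'⟩ := h r hr
  exact hsmall O hO hOr ⟨hz, hz'⟩

theorem continuousAt_of_forall_smallSet {X : Type*} [TopologicalSpace X] {f : X → LTop ℓ} {p : X}
    (h : ∀ r > 0, ∃ O, IsOpen O ∧ SmallSet ℓ r O ∧ f ⁻¹' O ∈ 𝓝 p) : ContinuousAt f p := by
  intro N hN
  obtain ⟨W, hW, hWN⟩ := UniformSpace.mem_nhds_iff.1 hN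
  obtain ⟨r, hr, hsmall⟩ :=
    exists_pos_forall_open_small (isUniformInducing_toLTop ℓ) (denseRange_toLTop ℓ) hW
  obtain ⟨O, hO, hOr, hOp⟩ := h r hr
  exact mem_of_superset hOp fun q hq =>
    hWN (hsmall O hO hOr ⟨mem_of_mem_nhds (s := f ⁻¹' O) hOp, hq⟩)

theorem edist_edgePt_le (ℓ : G.edgeSet → ℝ) {u v : V} (h : G.Adj u v) (s t : unitInterval) :
    edist (α := LPoint ℓ) (edgePt h s) (edgePt h t) ≤
      ENNReal.ofReal (ℓ ⟨s(u, v), h⟩ * |(s : ℝ) - t|) :=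
  iInf₂_le_of_le _ (.cons h s t (.refl _)) (by rw [add_zero])

theorem exists_mass_eq_one_edist_le (hℓ : LocallyBounded ℓ) (hη : η ≤ 1)
    (hA : ∀ u v (h : G.Adj u v), u ∈ A → v ∉ A → η * ℓ ⟨s(u, v), h⟩ ≤ r)
    {x : Point G} (hx : 1 - η < mass A x) :
    ∃ y : Point G, mass A y = 1 ∧ edist (α := LPoint ℓ) x y ≤ ENNReal.ofReal r := by
  obtain ⟨u, hu, hux⟩ := mass_pos_iff.1 ((sub_nonneg.2 hη).trans_lt hx)
  obtain rfl | ⟨v, h, t, rfl⟩ := eq_vtx_or_edgePt_of_pos hux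
  · exact ⟨vtx G u, by simp [mass_vtx, hu], (edist_self (α := LPoint ℓ) _).trans_le zero_le⟩
  by_cases hv : v ∈ A
  · exact ⟨edgePt h t, by simp [mass_edgePt, hu, hv],
      (edist_self (α := LPoint ℓ) _).trans_le zero_le⟩
  · have ht : (t : ℝ) < η := by simpa [mass_edgePt, hu, hv] using hx
    refine ⟨vtx G u, by simp [mass_vtx, hu], ?_⟩
    rw [← edgePt_zero h]
    refine (edist_edgePt_le ℓ h t 0).trans (ENNReal.ofReal_le_ofReal ?_)
    calc ℓ ⟨s(u, v), h⟩ * |(t : ℝ) - (0 : unitInterval)| = t * ℓ ⟨s(u, v), h⟩ := by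
          simp [abs_of_nonneg t.2.1, mul_comm]
      _ ≤ η * ℓ ⟨s(u, v), h⟩ := mul_le_mul_of_nonneg_right ht.le (hℓ.pos h).le
      _ ≤ r := hA u v h hu hv

/-- The points of `|G|_ℓ` at which `A` has mass greater than `1 - η`: a neighbourhood of the
vertices, and of the ends, of `A`. -/
def massNhd (ℓ : G.edgeSet → ℝ) (A : Set V) (η : ℝ) : Set (LTop ℓ) :=
  {z | 1 - η < massL ℓ A z}

theorem isOpen_massNhd (hℓ : LocallyBounded ℓ) (hA : FiniteBoundary G A) (η : ℝ) :
    IsOpen (massNhd ℓ A η) :=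
  isOpen_lt continuous_const (continuous_massL hℓ hA)

theorem mem_massNhd_of_eq_one {z : LTop ℓ} (hη : 0 < η) (hz : massL ℓ A z = 1) :
    z ∈ massNhd ℓ A η := by
  rw [massNhd, Set.mem_ofPred, hz]
  exact sub_lt_self 1 hη

theorem smallSet_massNhd (hℓ : LocallyBounded ℓ) (hA : FiniteBoundary G A) (hr : 0 ≤ r)
    (hη : η ≤ 1) (hAη : ∀ u v (h : G.Adj u v), u ∈ A → v ∉ A → η * ℓ ⟨s(u, v), h⟩ ≤ r)
    (hdiam : ∀ x y : Point G, mass A x = 1 → mass A y = 1 →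
      edist (α := LPoint ℓ) x y ≤ ENNReal.ofReal r) :
    SmallSet ℓ (r + r + r) (massNhd ℓ A η) := by
  intro x y hx hy
  rw [massNhd, Set.mem_ofPred, massL_toLTop hℓ hA x] at hx
  rw [massNhd, Set.mem_ofPred, massL_toLTop hℓ hA y] at hy
  obtain ⟨x', hx', hxx'⟩ := exists_mass_eq_one_edist_le hℓ hη hAη hx
  obtain ⟨y', hy', hyy'⟩ := exists_mass_eq_one_edist_le hℓ hη hAη hy
  rw [ENNReal.ofReal_add (add_nonneg hr hr) hr, ENNReal.ofReal_add hr hr]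
  exact (edist_triangle4 (α := LPoint ℓ) x x' y' y).trans
    (add_le_add (add_le_add hxx' (hdiam x' y' hx' hy'))
      ((edist_comm (α := LPoint ℓ) y' y).trans_le hyy'))

theorem exists_smallSet_massNhd (hℓ : LocallyBounded ℓ) (hA : FiniteBoundary G A) (hr : 0 < r)
    (hdiam : ∀ x y : Point G, mass A x = 1 → mass A y = 1 →
      edist (α := LPoint ℓ) x y ≤ ENNReal.ofReal (r / 3)) :
    ∃ η, 0 < η ∧ η < 1 ∧ SmallSet ℓ r (massNhd ℓ A η) := by
  obtain ⟨S, hS⟩ := hA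
  obtain ⟨K, hK, hKℓ⟩ := hℓ.exists_forall_mem S
  have hle : ∀ u v (h : G.Adj u v), u ∈ A → v ∉ A → ℓ ⟨s(u, v), h⟩ ≤ K := fun u v h hu hv =>
    (hS u v h hu hv).elim (fun huS => (hKℓ u huS v h).2)
      fun hvS => edge_swap h ▸ (hKℓ v hvS u h.symm).2
  have hη : min (1 / 2) (r / 3 / K) * K ≤ r / 3 :=
    (le_div_iff₀ hK).1 (min_le_right _ _)
  have hη0 : 0 < min (1 / 2) (r / 3 / K) := lt_min (by norm_num) (by positivity)
  have hη1 : min (1 / 2) (r / 3 / K) < 1 := (min_le_left _ _).trans_lt (by norm_num)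
  refine ⟨_, hη0, hη1, ?_⟩
  have := smallSet_massNhd hℓ ⟨S, hS⟩ (by positivity) hη1.le
    (fun u v h hu hv => (mul_le_mul_of_nonneg_left (hle u v h hu hv) hη0.le).trans hη) hdiam
  rwa [add_thirds] at this

theorem mass_singleton_eq_one_iff {v : V} {x : Point G} : mass {v} x = 1 ↔ x = vtx G v := by
  refine ⟨fun hx => ?_, fun hx => by simp [hx, mass_vtx]⟩
  obtain rfl | ⟨u, h, t, rfl⟩ := eq_vtx_or_edgePt_of_pos (hx ▸ one_pos)
  · rfl
  · obtain rfl : t = 0 := by simpa [mass_edgePt, h.ne'] using hx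
    rw [edgePt_zero]

theorem exists_smallSet_massNhd_singleton (hℓ : LocallyBounded ℓ) (v : V) (hr : 0 < r) :
    ∃ η, 0 < η ∧ η < 1 ∧ SmallSet ℓ r (massNhd ℓ {v} η) := by
  refine exists_smallSet_massNhd hℓ (finiteBoundary_singleton v) hr fun x y hx hy => ?_
  rw [mass_singleton_eq_one_iff.1 hx, mass_singleton_eq_one_iff.1 hy]
  exact (edist_self (α := LPoint ℓ) _).trans_le zero_le

theorem eq_toLTop_vtx (hℓ : LocallyBounded ℓ) {v : V} {z : LTop ℓ} (hz : massL ℓ {v} z = 1) :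
    z = toLTop ℓ (vtx G v) := by
  have hb := finiteBoundary_singleton (G := G) v
  refine eq_of_forall_smallSet fun r hr => ?_
  obtain ⟨η, hη, -, hsmall⟩ := exists_smallSet_massNhd_singleton hℓ v hr
  refine ⟨_, isOpen_massNhd hℓ hb η, hsmall, mem_massNhd_of_eq_one hη hz,
    mem_massNhd_of_eq_one hη ?_⟩
  rw [massL_toLTop hℓ hb, mass_singleton_eq_one_iff]

/-- For every `r > 0` there is a finite `S` such that the components of `G - S`, as subspaces of
the 1-complex, have diameter at most `r`. -/
def HasSmallComponents (ℓ : G.edgeSet → ℝ) : Prop :=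
  ∀ r > 0, ∃ S : Finset V, ∀ C, IsComp G S C →
    ∀ x y : Point G, mass C x = 1 → mass C y = 1 →
      edist (α := LPoint ℓ) x y ≤ ENNReal.ofReal r

theorem HasSmallComponents.exists_smallSet_massNhd (hsmall : HasSmallComponents ℓ)
    (hℓ : LocallyBounded ℓ) (hr : 0 < r) :
    ∃ S : Finset V, ∀ C, IsComp G S C → ∃ η, 0 < η ∧ η < 1 ∧ SmallSet ℓ r (massNhd ℓ C η) :=
  have ⟨S, hS⟩ := hsmall (r / 3) (by positivity)
  ⟨S, fun C hC => GraphTop.exists_smallSet_massNhd hℓ hC.finiteBoundary hr (hS C hC)⟩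

theorem HasSmallComponents.eq (hsmall : HasSmallComponents ℓ) (hℓ : LocallyBounded ℓ)
    {z z' : LTop ℓ}
    (h : ∀ S : Finset V, ∃ C, IsComp G S C ∧ massL ℓ C z = 1 ∧ massL ℓ C z' = 1) : z = z' := by
  refine eq_of_forall_smallSet fun r hr => ?_
  obtain ⟨S, hS⟩ := hsmall.exists_smallSet_massNhd hℓ hr
  obtain ⟨C, hC, hz, hz'⟩ := h S
  obtain ⟨η, hη, -, hCη⟩ := hS C hC
  exact ⟨_, isOpen_massNhd hℓ hC.finiteBoundary η, hCη, mem_massNhd_of_eq_one hη hz,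
    mem_massNhd_of_eq_one hη hz'⟩

end Small

/-! ### Inner points of edges -/

section Edges

variable {ℓ : G.edgeSet → ℝ} {u v : V}

theorem continuous_toLTop_edgePt (ℓ : G.edgeSet → ℝ) (h : G.Adj u v) :
    Continuous fun t => toLTop ℓ (edgePt h t) := by
  have hlip : LipschitzWith (β := LPoint ℓ) (ℓ ⟨s(u, v), h⟩).toNNReal (edgePt h) := fun s t => by
    refine (edist_edgePt_le ℓ h s t).trans_eq ?_
    rw [ENNReal.ofReal_mul' (abs_nonneg _), edist_dist, Subtype.dist_eq, Real.dist_eq]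
    rfl
  exact (isUniformInducing_toLTop ℓ).uniformContinuous.continuous.comp hlip.continuous

/-- The tent function on the edge `uv`, which vanishes off this edge. -/
noncomputable def tent (u v : V) (x : Point G) : ℝ :=
  min (mass {u} x) (mass {v} x)

theorem tent_pos_iff {x : Point G} : 0 < tent u v x ↔ 0 < mass {u} x ∧ 0 < mass {v} x :=
  lt_min_iff

theorem tent_nonneg (u v : V) (x : Point G) : 0 ≤ tent u v x :=
  le_min (mass_nonneg _ _) (mass_nonneg _ _)

theorem edgeLipschitz_tent (u v : V) : EdgeLipschitz {u} (tent (G := G) u v) where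
  abs_sub_le h s t := by
    refine (abs_min_sub_min_le_max _ _ _ _).trans (max_le ?_ ?_)
    exacts [(edgeLipschitz_mass_singleton u).abs_sub_le h s t,
      (edgeLipschitz_mass_singleton v).abs_sub_le h s t]
  eq_of_notMem {a b} h ha hb s t := by
    have hzero : ∀ r, tent u v (edgePt h r) = 0 := fun r => by
      refine (tent_nonneg u v _).antisymm' (min_le_of_left_le (le_of_eq ?_))
      rw [Finset.mem_singleton] at ha hb
      simp [mass_edgePt, ha, hb]
    rw [hzero, hzero]

theorem exists_edgePt_of_extL_tent_pos (hℓ : LocallyBounded ℓ) (h : G.Adj u v) {z : LTop ℓ}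
    (hz : 0 < extL ℓ (tent u v) z) : ∃ t, toLTop ℓ (edgePt h t) = z := by
  have hT := edgeLipschitz_tent (G := G) u v
  refine subset_of_forall_toLTop (F := Set.range fun t => toLTop ℓ (edgePt h t))
    (isOpen_lt continuous_const (hT.continuous_extL hℓ))
    (isCompact_range (continuous_toLTop_edgePt ℓ h)).isClosed (fun x hx => ?_) hz
  rw [Set.mem_ofPred, hT.extL_toLTop hℓ, tent_pos_iff] at hx
  obtain ⟨_, t, -, -, rfl⟩ := eq_edgePt_of_pos h.ne hx.1 hx.2
  exact ⟨t, rfl⟩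

theorem exists_point_of_massL_pos (hℓ : LocallyBounded ℓ) {z : LTop ℓ} (hz : 0 < massL ℓ {v} z) :
    ∃ x : Point G, toLTop ℓ x = z := by
  obtain hlt | heq := (massL_le_one hℓ (finiteBoundary_singleton v) z).lt_or_eq
  swap
  · exact ⟨vtx G v, (eq_toLTop_vtx hℓ heq).symm⟩
  obtain ⟨ε, hε, hεlt⟩ : ∃ ε > 0, ε < min (massL ℓ {v} z) (1 - massL ℓ {v} z) / 2 :=
    exists_between (half_pos (lt_min hz (sub_pos.2 hlt)))
  rw [lt_div_iff₀ two_pos, lt_min_iff] at hεlt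
  obtain ⟨x, hx⟩ := exists_point_forall_abs_extL_sub_le hℓ {v} z hε
  have hxv : |massL ℓ {v} z - mass {v} x| ≤ ε := hx _ (edgeLipschitz_mass_singleton v)
  rw [abs_le] at hxv
  obtain rfl | ⟨u, h, t, rfl⟩ := eq_vtx_or_edgePt_of_pos (by linarith : 0 < mass {v} x)
  · simp only [mass_vtx, Set.mem_singleton_iff, Set.indicator_of_mem, Pi.one_apply] at hxv
    linarith
  have htent := (abs_le.1 (hx _ (edgeLipschitz_tent v u))).1
  simp only [tent, mass_edgePt, Set.mem_singleton_iff, h.ne, h.ne', not_false_eq_true,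
    Set.indicator_of_mem, Set.indicator_of_notMem, Pi.one_apply, mul_zero, mul_one, add_zero,
    zero_add] at hxv htent
  have hεt : ε < min (1 - (t : ℝ)) t := lt_min (by linarith) (by linarith)
  obtain ⟨s, hs⟩ := exists_edgePt_of_extL_tent_pos hℓ h (z := z) (by linarith)
  exact ⟨_, hs⟩

end Edges

/-! ### Directions -/

section Directions

open Filter

theorem tendsto_atTop_of_lt_or_eq_and_lt {a d : ℕ → ℕ}
    (h : ∀ n, a n < a (n + 1) ∨ a n = a (n + 1) ∧ d (n + 1) < d n) : Tendsto a atTop atTop := by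
  have hmono : Monotone a := monotone_nat_of_le_succ fun n => (h n).elim le_of_lt fun h => h.1.le
  refine (tendsto_atTop_of_monotone hmono).resolve_right fun ⟨l, hl⟩ => ?_
  rw [nhds_discrete, tendsto_pure, eventually_atTop] at hl
  obtain ⟨N, hN⟩ := hl
  have hconst : ∀ n, a (N + n) = l := fun n => hN _ (Nat.le_add_right N n)
  refine not_strictAnti_of_wellFoundedLT (fun n => d (N + n))
    (strictAnti_nat_of_succ_lt fun n => ?_)
  exact ((h (N + n)).resolve_left ((hconst n).trans (hconst (n + 1)).symm).not_lt).2

/-- The length of a shortest walk that leads from `u` to greater height without passing below the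
height of `u`, for a height function `L`. -/
noncomputable def climbDist (G : SimpleGraph V) (L : V → ℕ) (u : V) : ℕ :=
  sInf {k | ∃ v, L u < L v ∧ ∃ p : G.Walk u v, (∀ x ∈ p.support, L u ≤ L x) ∧ p.length = k}

theorem exists_adj_climbDist_lt {L : V → ℕ} {u : V}
    (hu : ∃ v, L u < L v ∧ ∃ p : G.Walk u v, ∀ x ∈ p.support, L u ≤ L x) :
    ∃ y, G.Adj u y ∧ (L u < L y ∨ L u = L y ∧ climbDist G L y < climbDist G L u) := by
  have hne : {k | ∃ v, L u < L v ∧ ∃ p : G.Walk u v, (∀ x ∈ p.support, L u ≤ L x) ∧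
      p.length = k}.Nonempty :=
    have ⟨v, hv, p, hp⟩ := hu
    ⟨_, v, hv, p, hp, rfl⟩
  obtain ⟨v, hv, p, hp, hlen⟩ := Nat.sInf_mem hne
  cases p with
  | nil => exact (hv.false).elim
  | @cons _ y _ h p =>
    have hp' : ∀ x ∈ p.support, L u ≤ L x := fun x hx => hp x (List.mem_cons_of_mem _ hx)
    refine ⟨y, h, (hp' y p.start_mem_support).lt_or_eq.imp_right fun heq => ⟨heq, ?_⟩⟩
    calc climbDist G L y ≤ p.length := Nat.sInf_le ⟨v, heq ▸ hv, p, heq ▸ hp', rfl⟩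
      _ < (SimpleGraph.Walk.cons h p).length := Nat.lt_succ_self _
      _ = climbDist G L u := hlen

theorem exists_ray_tendsto_atTop {L : V → ℕ} (v₀ : V)
    (hclimb : ∀ u, L v₀ ≤ L u →
      ∃ v, L u < L v ∧ ∃ p : G.Walk u v, ∀ x ∈ p.support, L u ≤ L x) :
    ∃ R : Ray G, Tendsto (fun n => L (R.toFun n)) atTop atTop := by
  have hstep : ∀ u : {u // L v₀ ≤ L u}, ∃ y : {u // L v₀ ≤ L u}, G.Adj u y ∧
      (L u < L y ∨ L u = L y ∧ climbDist G L y < climbDist G L u) := fun ⟨u, hu⟩ =>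
    have ⟨y, hy, hlt⟩ := exists_adj_climbDist_lt (hclimb u hu)
    ⟨⟨y, hu.trans (hlt.elim le_of_lt fun h => h.1.le)⟩, hy, hlt⟩
  choose g hadj hg using hstep
  let x : ℕ → {u // L v₀ ≤ L u} := fun n => g^[n] ⟨v₀, le_rfl⟩
  have hx : ∀ n, x (n + 1) = g (x n) := fun n => Function.iterate_succ_apply' g n _
  have hlex : ∀ n, L (x n) < L (x (n + 1)) ∨
      L (x n) = L (x (n + 1)) ∧ climbDist G L (x (n + 1)) < climbDist G L (x n) := fun n =>
    hx n ▸ hg (x n)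
  have hmono : StrictMono fun n =>
      toLex ((L (x n), OrderDual.toDual (climbDist G L (x n))) : ℕ × ℕᵒᵈ) :=
    strictMono_nat_of_lt_succ fun n => Prod.Lex.toLex_lt_toLex.2 (hlex n)
  refine ⟨⟨fun n => x n, fun m n hmn => hmono.injective ?_, fun n => hx n ▸ hadj (x n)⟩,
    tendsto_atTop_of_lt_or_eq_and_lt (d := fun n => climbDist G L (x n)) hlex⟩
  simp only [hmn]

/-- A direction of `G`: a choice, for every finite set `S` of vertices, of a component of `G - S`,
such that any two of the chosen components meet. -/
structure IsDirection (G : SimpleGraph V) (C : Finset V → Set V) : Prop where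
  isComp (S : Finset V) : IsComp G S (C S)
  inter_nonempty (S T : Finset V) : (C S ∩ C T).Nonempty

namespace IsDirection

variable {C : Finset V → Set V}

theorem antitone (hC : IsDirection G C) : Antitone C := fun S T hST =>
  have ⟨_, hu, hu'⟩ := hC.inter_nonempty S T
  (hC.isComp S).subset (hC.isComp T) hST hu hu'

theorem exists_ray [Countable V] (hC : IsDirection G C) :
    ∃ R : Ray G, ∀ S, ∀ᶠ i in atTop, R.toFun i ∈ C S := by
  classical
  obtain ⟨s, hs, hs_top⟩ := exists_seq_monotone_tendsto_atTop_atTop (Finset V)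
  have hleave : ∀ v, ∃ n, v ∉ C (s n) := fun v =>
    have ⟨n, hn⟩ := (hs_top.eventually_ge_atTop {v}).exists
    ⟨n, fun hv => (hC.isComp _).notMem hv (Finset.singleton_subset_iff.1 hn)⟩
  -- `L v` counts the members of the decreasing sequence `C (s n)` that contain `v`.
  let L : V → ℕ := fun v => Nat.find (hleave v)
  have lt_L_iff : ∀ {n v}, n < L v ↔ v ∈ C (s n) := fun {n v} => by
    rw [Nat.lt_find_iff]
    exact ⟨fun h => not_not.1 (h n le_rfl), fun h m hm => not_not.2 (hC.antitone (hs hm) h)⟩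
  obtain ⟨v₀, hv₀, -⟩ := hC.inter_nonempty (s 0) (s 0)
  obtain ⟨R, hR⟩ := exists_ray_tendsto_atTop (G := G) (L := L) v₀ fun u hu => by
    obtain ⟨n, hn⟩ := Nat.exists_eq_succ_of_ne_zero ((lt_L_iff.2 hv₀).trans_le hu).ne'
    obtain ⟨v, hv, hv'⟩ := hC.inter_nonempty (s (L u)) (s n)
    obtain ⟨p, hp⟩ := (hC.isComp (s n)).exists_walk (lt_L_iff.1 (hn ▸ n.lt_succ_self)) hv'
    exact ⟨v, lt_L_iff.2 hv, p, fun x hx => hn ▸ lt_L_iff.2 (hp x hx)⟩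
  refine ⟨R, fun S => ?_⟩
  obtain ⟨n, hn⟩ := (hs_top.eventually_ge_atTop S).exists
  filter_upwards [hR.eventually_gt_atTop n] with i hi
  exact hC.antitone hn (lt_L_iff.1 hi)

theorem exists_end [Countable V] (hC : IsDirection G C) :
    ∃ ω : VertexEnd G, ∀ S, compVerts G S ω = C S := by
  obtain ⟨R, hR⟩ := hC.exists_ray
  refine ⟨Quotient.mk (raySetoid G) R, fun S => ?_⟩
  obtain ⟨n, hn⟩ := Ray.BelongsTo.exists_forall_mem (R := R) rfl S
  obtain ⟨i, hi, hin⟩ := ((hR S).and (eventually_ge_atTop n)).exists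
  exact (isComp_compVerts G S _).eq (hC.isComp S) (hn i hin) hi

end IsDirection

end Directions

/-! ### The homeomorphism -/

section PointSets

theorem point_mem_openStar_iff {v : V} {ε : ℝ} (h0 : 0 < ε) (h1 : ε < 1) {x : Point G} :
    MTop.point x ∈ openStar G v ε ↔ 1 - ε < mass {v} x := by
  constructor
  · rintro (h | ⟨u, h, t, ht, hx⟩)
    · obtain rfl := MTop.point.inj h
      simpa [mass_vtx] using h0
    · obtain rfl := MTop.point.inj hx
      simpa [mass_edgePt, h.ne'] using ht
  · intro hx
    obtain rfl | ⟨u, h, t, rfl⟩ := eq_vtx_or_edgePt_of_pos ((sub_pos.2 h1).trans hx)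
    · exact .inl rfl
    · exact .inr ⟨u, h, t, by simpa [mass_edgePt, h.ne'] using hx, rfl⟩

theorem point_mem_edgeSub_iff {u v : V} (h : G.Adj u v) {U : Set ℝ} {x : Point G} :
    MTop.point x ∈ edgeSub h (Subtype.val ⁻¹' U) ↔
      0 < mass {u} x ∧ 0 < mass {v} x ∧ mass {v} x ∈ U := by
  have hu : ∀ t, mass {u} (edgePt h t) = 1 - t := fun t => by simp [mass_edgePt, h.ne']
  have hv : ∀ t, mass {v} (edgePt h t) = t := fun t => by simp [mass_edgePt, h.ne]
  constructor
  · rintro ⟨t, htU, h0, h1, hx⟩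
    obtain rfl := MTop.point.inj hx
    rw [hu, hv]
    exact ⟨sub_pos.2 h1, h0, htU⟩
  · rintro ⟨hux, hvx, hU⟩
    obtain ⟨_, t, h0, h1, rfl⟩ := eq_edgePt_of_pos h.ne hux hvx
    rw [hv] at hU
    exact ⟨t, hU, h0, h1, rfl⟩

theorem point_mem_endNhd_iff {S : Finset V} {ω : VertexEnd G} {ε : ℝ} (h0 : 0 < ε)
    {x : Point G} :
    MTop.point x ∈ endNhd G S ω ε ↔ 1 - min ε 1 < mass (compVerts G S ω) x := by
  have hC := isComp_compVerts G S ω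
  constructor
  · rintro (⟨v, hv, hx⟩ | ⟨u, hu, v, hv, h, t, hx⟩ | ⟨_, _, _, _, hx⟩ |
      ⟨u, hu, v, hv, h, t, -, ht1, htε, hx⟩)
    · obtain rfl := MTop.point.inj hx
      simpa [mass_vtx, hv] using h0
    · obtain rfl := MTop.point.inj hx
      simpa [mass_edgePt, hu, hv] using h0
    · cases hx
    · obtain rfl := MTop.point.inj hx
      have hvC : v ∉ compVerts G S ω := fun hvC => hC.notMem hvC hv
      simpa [mass_edgePt, hu, hvC] using ⟨htε, ht1⟩
  · intro hx
    obtain ⟨u, hu, hux⟩ := mass_pos_iff.1 ((sub_nonneg.2 (min_le_right ε 1)).trans_lt hx)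
    obtain rfl | ⟨v, h, t, rfl⟩ := eq_vtx_or_edgePt_of_pos hux
    · exact .inl ⟨u, hu, rfl⟩
    by_cases hv : v ∈ compVerts G S ω
    · exact .inr (.inl ⟨u, hu, v, hv, h, t, rfl⟩)
    obtain rfl | ht := eq_or_ne t 0
    · exact .inl ⟨u, hu, congrArg _ (edgePt_zero h)⟩
    have htε : (t : ℝ) < ε ∧ (t : ℝ) < 1 := by simpa [mass_edgePt, hu, hv] using hx
    exact .inr (.inr (.inr ⟨u, hu, v, hC.mem_of_adj_of_notMem hu h hv, h, t,
      unitInterval.pos_iff_ne_zero.2 ht, htε.2, htε.1, rfl⟩))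

end PointSets

section Completion

open Topology Filter

variable {ℓ : G.edgeSet → ℝ} {ω ω' : VertexEnd G} {z : LTop ℓ}

/-- The point `z` of `|G|_ℓ` is the limit of the end `ω`: it lies in the closure of every component
`C(S, ω)`, and off the edges that leave this component. -/
def IsEndLimit (ω : VertexEnd G) (z : LTop ℓ) : Prop :=
  ∀ S, massL ℓ (compVerts G S ω) z = 1

theorem HasSmallComponents.exists_isEndLimit (hsmall : HasSmallComponents ℓ)
    (hℓ : LocallyBounded ℓ) (ω : VertexEnd G) : ∃ z : LTop ℓ, IsEndLimit ω z := by
  obtain ⟨R, hR⟩ := ω.exists_ray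
  have hone : ∀ S, ∃ n, ∀ i ≥ n, mass (compVerts G S ω) (vtx G (R.toFun i)) = 1 := fun S =>
    have ⟨n, hn⟩ := hR.exists_forall_mem S
    ⟨n, fun i hi => by rw [mass_vtx, Set.indicator_of_mem (hn i hi), Pi.one_apply]⟩
  have hcauchy : CauchySeq (α := LPoint ℓ) fun n => vtx G (R.toFun n) := by
    refine EMetric.cauchySeq_iff.2 fun ε hε => ?_
    obtain ⟨r, hr0, hrε⟩ := ENNReal.lt_iff_exists_nnreal_btwn.1 hε
    obtain ⟨S, hS⟩ := hsmall r (by simpa using hr0)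
    obtain ⟨n, hn⟩ := hone S
    exact ⟨n, fun i hi j hj => (hS _ (isComp_compVerts G S ω) _ _ (hn i hi) (hn j hj)).trans_lt
      (by simpa using hrε)⟩
  obtain ⟨z, hz⟩ := cauchySeq_tendsto_of_complete
    ((isUniformInducing_toLTop ℓ).uniformContinuous.comp_cauchySeq hcauchy)
  refine ⟨z, fun S => ?_⟩
  have hC := (isComp_compVerts G S ω).finiteBoundary
  refine tendsto_nhds_unique (((continuous_massL hℓ hC).tendsto z).comp hz)
    (tendsto_const_nhds.congr' ?_)
  obtain ⟨n, hn⟩ := hone S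
  filter_upwards [eventually_ge_atTop n] with i hi
  exact ((massL_toLTop hℓ hC _).trans (hn i hi)).symm

theorem IsEndLimit.massL_singleton (hz : IsEndLimit ω z) (hℓ : LocallyBounded ℓ) (v : V) :
    massL ℓ {v} z = 0 := by
  have hC := isComp_compVerts G {v} ω
  have hle := massL_add_le_one hℓ (finiteBoundary_singleton v) hC.finiteBoundary
    (Finset.coe_singleton v ▸ hC.disjoint_coe.symm) z
  rw [hz] at hle
  exact (massL_nonneg hℓ (finiteBoundary_singleton v) z).antisymm' (by linarith)

theorem IsEndLimit.massL_compVerts_pos_iff (hz : IsEndLimit ω z) (hℓ : LocallyBounded ℓ)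
    {S : Finset V} :
    0 < massL ℓ (compVerts G S ω') z ↔ compVerts G S ω = compVerts G S ω' := by
  have hC := isComp_compVerts G S ω
  have hC' := isComp_compVerts G S ω'
  refine ⟨fun hpos => by_contra fun hne => ?_, fun heq => by rw [← heq, hz]; exact one_pos⟩
  have hdisj : Disjoint (compVerts G S ω) (compVerts G S ω') :=
    Set.disjoint_left.2 fun u hu hu' => hne (hC.eq hC' hu hu')
  have hle := massL_add_le_one hℓ hC.finiteBoundary hC'.finiteBoundary hdisj z
  rw [hz] at hle
  linarith

/-- The extension of the canonical map to `|G|_ℓ` by the points `e ω` at the ends `ω`. -/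
noncomputable def ofMTop (ℓ : G.edgeSet → ℝ) (e : VertexEnd G → LTop ℓ) : MTop G → LTop ℓ
  | .point x => toLTop ℓ x
  | .vend ω => e ω

variable {e : VertexEnd G → LTop ℓ}

theorem preimage_openStar (hℓ : LocallyBounded ℓ) (he : ∀ ω, IsEndLimit ω (e ω)) (v : V) {ε : ℝ}
    (h0 : 0 < ε) (h1 : ε < 1) : ofMTop ℓ e ⁻¹' massNhd ℓ {v} ε = openStar G v ε := by
  ext (x | ω)
  · rw [point_mem_openStar_iff h0 h1, Set.mem_preimage, massNhd, Set.mem_ofPred, ofMTop,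
      massL_toLTop hℓ (finiteBoundary_singleton v)]
  · rw [Set.mem_preimage, massNhd, Set.mem_ofPred, ofMTop, (he ω).massL_singleton hℓ]
    refine ⟨fun h => absurd h (by linarith), ?_⟩
    rintro (h | ⟨_, _, _, _, h⟩) <;> cases h

theorem preimage_edgeSub (hℓ : LocallyBounded ℓ) (he : ∀ ω, IsEndLimit ω (e ω)) {u v : V}
    (h : G.Adj u v) (U : Set ℝ) :
    ofMTop ℓ e ⁻¹' {z | 0 < massL ℓ {u} z ∧ 0 < massL ℓ {v} z ∧ massL ℓ {v} z ∈ U} =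
      edgeSub h (Subtype.val ⁻¹' U) := by
  ext (x | ω)
  · rw [point_mem_edgeSub_iff, Set.mem_preimage, Set.mem_ofPred, ofMTop,
      massL_toLTop hℓ (finiteBoundary_singleton u), massL_toLTop hℓ (finiteBoundary_singleton v)]
  · rw [Set.mem_preimage, Set.mem_ofPred, ofMTop, (he ω).massL_singleton hℓ u]
    refine ⟨fun h => absurd h.1 (lt_irrefl _), ?_⟩
    rintro ⟨_, _, _, _, h⟩
    cases h

theorem vend_mem_endNhd_iff {S : Finset V} {ε : ℝ} :
    MTop.vend ω' ∈ endNhd G S ω ε ↔ compVerts G S ω' = compVerts G S ω := by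
  rw [← exists_ray_in_compVerts_iff]
  constructor
  · rintro (⟨_, _, hx⟩ | ⟨_, _, _, _, _, _, hx⟩ | ⟨ω'', R, hR, hR', hx⟩ |
      ⟨_, _, _, _, _, _, _, _, _, hx⟩) <;> cases hx
    exact ⟨R, hR, hR'⟩
  · rintro ⟨R, hR, hR'⟩
    exact .inr (.inr (.inl ⟨ω', R, hR, hR', rfl⟩))

theorem preimage_endNhd (hℓ : LocallyBounded ℓ) (he : ∀ ω, IsEndLimit ω (e ω)) (S : Finset V)
    (ω : VertexEnd G) {ε : ℝ} (h0 : 0 < ε) :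
    ofMTop ℓ e ⁻¹' massNhd ℓ (compVerts G S ω) (min ε 1) = endNhd G S ω ε := by
  ext (x | ω')
  · rw [point_mem_endNhd_iff h0, Set.mem_preimage, massNhd, Set.mem_ofPred, ofMTop,
      massL_toLTop hℓ (isComp_compVerts G S ω).finiteBoundary]
  · rw [vend_mem_endNhd_iff, Set.mem_preimage, massNhd, Set.mem_ofPred, ofMTop]
    constructor
    · intro h
      exact ((he ω').massL_compVerts_pos_iff hℓ).1
        ((sub_nonneg.2 (min_le_right ε 1)).trans_lt h)
    · intro h
      rw [← h, he ω']
      exact sub_lt_self 1 (lt_min h0 one_pos)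

theorem continuousAt_ofMTop_vtx (hℓ : LocallyBounded ℓ) (he : ∀ ω, IsEndLimit ω (e ω)) (v : V) :
    ContinuousAt (ofMTop ℓ e) (.point (vtx G v)) := by
  refine continuousAt_of_forall_smallSet fun r hr => ?_
  obtain ⟨η, hη0, hη1, hsmall⟩ := exists_smallSet_massNhd_singleton hℓ v hr
  refine ⟨_, isOpen_massNhd hℓ (finiteBoundary_singleton v) η, hsmall, ?_⟩
  rw [preimage_openStar hℓ he v hη0 hη1]
  exact (TopologicalSpace.isOpen_generateFrom_of_mem
    (.inl (.inr ⟨v, η, hη0, hη1, rfl⟩))).mem_nhds (.inl rfl)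

theorem continuousAt_ofMTop_edgePt (e : VertexEnd G → LTop ℓ) {u v : V} (h : G.Adj u v)
    {t : unitInterval} (h0 : 0 < t) (h1 : t < 1) :
    ContinuousAt (ofMTop ℓ e) (.point (edgePt h t)) := by
  refine fun N hN => mem_map.2 ?_
  obtain ⟨O, hON, hO, htO⟩ := mem_nhds_iff.1 hN
  have hopen : IsOpen (edgeSub h ((fun s => toLTop ℓ (edgePt h s)) ⁻¹' O)) :=
    TopologicalSpace.isOpen_generateFrom_of_mem
      (.inl (.inl ⟨u, v, h, _, hO.preimage (continuous_toLTop_edgePt ℓ h), rfl⟩))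
  refine mem_of_superset (hopen.mem_nhds ⟨t, htO, h0, h1, rfl⟩) ?_
  rintro _ ⟨s, hs, -, -, rfl⟩
  exact hON hs

theorem HasSmallComponents.continuousAt_ofMTop_vend (hsmall : HasSmallComponents ℓ)
    (hℓ : LocallyBounded ℓ) (he : ∀ ω, IsEndLimit ω (e ω)) (ω : VertexEnd G) :
    ContinuousAt (ofMTop ℓ e) (.vend ω) := by
  refine continuousAt_of_forall_smallSet fun r hr => ?_
  obtain ⟨S, hS⟩ := hsmall.exists_smallSet_massNhd hℓ hr
  have hC := isComp_compVerts G S ω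
  obtain ⟨η, hη0, hη1, hCη⟩ := hS _ hC
  have hpre := preimage_endNhd hℓ he S ω hη0
  rw [min_eq_left hη1.le] at hpre
  refine ⟨_, isOpen_massNhd hℓ hC.finiteBoundary η, hCη, ?_⟩
  rw [hpre]
  exact (TopologicalSpace.isOpen_generateFrom_of_mem (.inr ⟨S, ω, η, hη0, rfl⟩)).mem_nhds
    (vend_mem_endNhd_iff.2 rfl)

theorem HasSmallComponents.continuous_ofMTop (hsmall : HasSmallComponents ℓ)
    (hℓ : LocallyBounded ℓ) (he : ∀ ω, IsEndLimit ω (e ω)) : Continuous (ofMTop ℓ e) := by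
  refine continuous_iff_continuousAt.2 fun p => ?_
  obtain x | ω := p
  swap
  · exact hsmall.continuousAt_ofMTop_vend hℓ he ω
  obtain ⟨v, rfl⟩ | ⟨u, v, h, t, rfl⟩ := x.eq_vtx_or_edgePt
  · exact continuousAt_ofMTop_vtx hℓ he v
  obtain rfl | ht0 := eq_or_ne t 0
  · exact edgePt_zero h ▸ continuousAt_ofMTop_vtx hℓ he u
  obtain rfl | ht1 := eq_or_ne t 1
  · exact edgePt_one h ▸ continuousAt_ofMTop_vtx hℓ he v
  · exact continuousAt_ofMTop_edgePt e h (unitInterval.pos_iff_ne_zero.2 ht0)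
      (unitInterval.lt_one_iff_ne_one.2 ht1)

theorem HasSmallComponents.isInducing_ofMTop (hsmall : HasSmallComponents ℓ)
    (hℓ : LocallyBounded ℓ) (he : ∀ ω, IsEndLimit ω (e ω)) : IsInducing (ofMTop ℓ e) := by
  have hcont := fun v => continuous_massL hℓ (finiteBoundary_singleton (G := G) v)
  refine ⟨le_antisymm (hsmall.continuous_ofMTop hℓ he).le_induced (le_generateFrom ?_)⟩
  rintro _ ((⟨u, v, h, _, hU, rfl⟩ | ⟨v, ε, h0, h1, rfl⟩) | ⟨S, ω, ε, h0, rfl⟩)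
  · obtain ⟨U, hU', rfl⟩ := isOpen_induced_iff.1 hU
    exact isOpen_induced_iff.2 ⟨_, (isOpen_lt continuous_const (hcont u)).inter
      ((isOpen_lt continuous_const (hcont v)).inter (hU'.preimage (hcont v))),
      preimage_edgeSub hℓ he h U⟩
  · exact isOpen_induced_iff.2 ⟨_, isOpen_massNhd hℓ (finiteBoundary_singleton v) ε,
      preimage_openStar hℓ he v h0 h1⟩
  · exact isOpen_induced_iff.2 ⟨_, isOpen_massNhd hℓ (isComp_compVerts G S ω).finiteBoundary _,
      preimage_endNhd hℓ he S ω h0⟩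

theorem IsEndLimit.ne_toLTop (hz : IsEndLimit ω z) (hℓ : LocallyBounded ℓ) (x : Point G) :
    z ≠ toLTop ℓ x := by
  rintro rfl
  obtain ⟨v, hv⟩ := exists_mass_singleton_pos x
  rw [← massL_toLTop hℓ (finiteBoundary_singleton v), hz.massL_singleton hℓ] at hv
  exact hv.false

theorem injective_toLTop (hℓ : LocallyBounded ℓ) : Function.Injective (toLTop ℓ) := fun x y h =>
  Point.ext_mass fun v => by
    rw [← massL_toLTop hℓ (finiteBoundary_singleton v), h,
      massL_toLTop hℓ (finiteBoundary_singleton v)]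

theorem IsEndLimit.unique_end (hz : IsEndLimit ω z) (hz' : IsEndLimit ω' z)
    (hℓ : LocallyBounded ℓ) : ω = ω' :=
  VertexEnd.ext_compVerts fun S => (hz.massL_compVerts_pos_iff hℓ).1 (hz' S ▸ one_pos)

theorem injective_ofMTop (hℓ : LocallyBounded ℓ) (he : ∀ ω, IsEndLimit ω (e ω)) :
    Function.Injective (ofMTop ℓ e) := by
  rintro (x | ω) (y | ω') h
  · exact congrArg _ (injective_toLTop hℓ h)
  · exact ((he ω').ne_toLTop hℓ x h.symm).elim
  · exact ((he ω).ne_toLTop hℓ y h).elim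
  · exact congrArg _ ((he ω).unique_end ((show e ω = e ω' from h) ▸ he ω') hℓ)

theorem exists_isComp_massL_eq_one (hℓ : LocallyBounded ℓ) (hz : ∀ v, massL ℓ {v} z = 0)
    (S : Finset V) : ∃ C, IsComp G S C ∧ massL ℓ C z = 1 := by
  have hzS : massL ℓ S z = 0 := by
    rw [massL_finset hℓ]
    exact Finset.sum_eq_zero fun v _ => hz v
  -- A component has mass `1` at `z` as soon as its mass there is positive, so that a point `x` of
  -- the 1-complex approximating `z` to within `1 / 4` detects it.
  obtain ⟨x, hx⟩ := exists_point_forall_abs_extL_sub_le hℓ S z (ε := 1 / 4) (by norm_num)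
  have hxS : |massL ℓ S z - mass S x| ≤ 1 / 4 := hx _ (edgeLipschitz_mass fun _ _ _ hu _ => .inl hu)
  rw [hzS, abs_le] at hxS
  obtain ⟨u, hu, hux⟩ := mass_pos_iff.1
    (by linarith [mass_compl_add (S : Set V) x] : 0 < mass (S : Set V)ᶜ x)
  have hC := isComp_setOf_joined G S u
  have hxC : |massL ℓ {v | Joined G S u v} z - mass {v | Joined G S u v} x| ≤ 1 / 4 :=
    hx _ hC.edgeLipschitz_mass
  rw [abs_le] at hxC
  have hCx := hC.mass_add_eq_one (mass_pos_iff.2 ⟨u, joined_self hu, hux⟩)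
  have hCz := hC.massL_add_eq_one hℓ (z := z) (by linarith)
  exact ⟨_, hC, by linarith⟩

theorem exists_isEndLimit_of_forall_massL_eq_zero [Countable V] (hℓ : LocallyBounded ℓ)
    (hz : ∀ v, massL ℓ {v} z = 0) : ∃ ω, IsEndLimit ω z := by
  choose C hC hCz using exists_isComp_massL_eq_one hℓ hz
  have hdir : IsDirection G C := ⟨hC, fun S T => by
    by_contra hST
    have hle := massL_add_le_one hℓ (hC S).finiteBoundary (hC T).finiteBoundary
      (Set.disjoint_iff_inter_eq_empty.2 (Set.not_nonempty_iff_eq_empty.1 hST)) z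
    norm_num [hCz] at hle⟩
  obtain ⟨ω, hω⟩ := hdir.exists_end
  exact ⟨ω, fun S => hω S ▸ hCz S⟩

theorem HasSmallComponents.surjective_ofMTop [Countable V] (hsmall : HasSmallComponents ℓ)
    (hℓ : LocallyBounded ℓ) (he : ∀ ω, IsEndLimit ω (e ω)) :
    Function.Surjective (ofMTop ℓ e) := by
  intro z
  by_cases hz : ∃ v, 0 < massL ℓ {v} z
  · obtain ⟨v, hv⟩ := hz
    obtain ⟨x, hx⟩ := exists_point_of_massL_pos hℓ hv
    exact ⟨.point x, hx⟩
  · push Not at hz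
    obtain ⟨ω, hω⟩ := exists_isEndLimit_of_forall_massL_eq_zero hℓ fun v =>
      (hz v).antisymm (massL_nonneg hℓ (finiteBoundary_singleton v) z)
    exact ⟨.vend ω, hsmall.eq hℓ fun S => ⟨_, isComp_compVerts G S ω, he ω S, hω S⟩⟩

end Completion

/-! ### Edge lengths from summable vertex weights -/

section MeanLength

variable {w : V → ℝ}

theorem meanLength_mk {u v : V} (h : G.Adj u v) : meanLength G w ⟨s(u, v), h⟩ = (w u + w v) / 2 :=
  rfl

theorem route_meanLength_of_walk {u v : V} (p : G.Walk u v) :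
    Route (meanLength G w) (vtx G u) (vtx G v) ((p.support.map w).sum - (w u + w v) / 2) := by
  induction p with
  | nil => simpa using Route.refl _
  | @cons u v _ h p ih =>
    rw [← edgePt_one h] at ih
    have hroute := Route.cons h 0 1 ih
    rw [edgePt_zero, meanLength_mk] at hroute
    convert hroute using 1
    simp only [SimpleGraph.Walk.support_cons, List.map_cons, List.sum_cons, Set.Icc.coe_zero,
      Set.Icc.coe_one, zero_sub, abs_neg, abs_one]
    ring

theorem edist_meanLength_vtx_le_of_joined (hw : ∀ v, 0 ≤ w v) {S : Finset V} {r : ℝ}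
    (hS : ∀ T, Disjoint T S → ∑ v ∈ T, w v ≤ r) {u v : V} (h : Joined G S u v) :
    edist (α := LPoint (meanLength G w)) (vtx G u) (vtx G v) ≤ ENNReal.ofReal r := by
  classical
  obtain ⟨p, hp⟩ := h
  have hsum : (p.bypass.support.map w).sum ≤ r := by
    rw [← List.sum_toFinset w p.bypass_isPath.support_nodup]
    exact hS _ (Finset.disjoint_left.2 fun x hx =>
      hp x (p.support_bypass_subset_support (List.mem_toFinset.1 hx)))
  refine iInf₂_le_of_le _ (route_meanLength_of_walk p.bypass) (ENNReal.ofReal_le_ofReal ?_)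
  linarith [hw u, hw v]

theorem IsComp.exists_edist_meanLength_vtx_le {S : Finset V} {C : Set V} {r : ℝ}
    (hC : IsComp G S C) (hw : ∀ v, 0 ≤ w v) (hS : ∀ v ∉ S, w v ≤ r) {x : Point G}
    (hx : mass C x = 1) :
    ∃ u ∈ C, edist (α := LPoint (meanLength G w)) x (vtx G u) ≤ ENNReal.ofReal r := by
  obtain ⟨u, hu, hux⟩ := mass_pos_iff.1 (hx ▸ one_pos)
  refine ⟨u, hu, ?_⟩
  obtain rfl | ⟨v, h, t, rfl⟩ := eq_vtx_or_edgePt_of_pos hux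
  · exact (edist_self (α := LPoint _) _).trans_le zero_le
  rw [← edgePt_zero h]
  by_cases hv : v ∈ C
  · refine (edist_edgePt_le _ h t 0).trans (ENNReal.ofReal_le_ofReal ?_)
    have hu' := hS u (hC.notMem hu)
    have hv' := hS v (hC.notMem hv)
    calc meanLength G w ⟨s(u, v), h⟩ * |(t : ℝ) - (0 : unitInterval)|
        = (w u + w v) / 2 * t := by simp [meanLength_mk, abs_of_nonneg t.2.1]
      _ ≤ (w u + w v) / 2 :=
        mul_le_of_le_one_right (by linarith [hw u, hw v]) t.2.2
      _ ≤ r := by linarith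
  · obtain rfl : t = 0 := by simpa [mass_edgePt, hu, hv] using hx
    exact (edist_self (α := LPoint _) _).trans_le zero_le

theorem locallyBounded_meanLength (hw : ∀ v, 0 < w v) (hs : Summable w) :
    LocallyBounded (meanLength G w) := by
  intro v
  have hM : 0 < ∑' u, w u := hs.tsum_pos (fun u => (hw u).le) v (hw v)
  refine ⟨max (w v / 2)⁻¹ (∑' u, w u), hM.trans_le (le_max_right _ _), fun u h => ⟨?_, ?_⟩⟩
  · refine (inv_anti₀ (inv_pos.2 (half_pos (hw v))) (le_max_left _ _)).trans ?_
    rw [inv_inv, meanLength_mk]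
    linarith [hw u]
  · refine le_max_of_le_right ?_
    have hle := fun u => hs.le_tsum u fun i _ => (hw i).le
    rw [meanLength_mk]
    linarith [hle u, hle v]

theorem hasSmallComponents_meanLength (hw : ∀ v, 0 ≤ w v) (hs : Summable w) :
    HasSmallComponents (meanLength G w) := by
  intro r hr
  obtain ⟨S, hS⟩ := summable_iff_vanishing_norm.1 hs (r / 3) (by positivity)
  have hsum : ∀ T, Disjoint T S → ∑ v ∈ T, w v ≤ r / 3 := fun T hT =>
    (le_abs_self _).trans (hS T hT).le
  have hle : ∀ v ∉ S, w v ≤ r / 3 := fun v hv => by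
    simpa using hsum {v} (Finset.disjoint_singleton_left.2 hv)
  refine ⟨S, fun C hC x y hx hy => ?_⟩
  obtain ⟨u, hu, hxu⟩ := hC.exists_edist_meanLength_vtx_le hw hle hx
  obtain ⟨v, hv, hyv⟩ := hC.exists_edist_meanLength_vtx_le hw hle hy
  have huv := edist_meanLength_vtx_le_of_joined hw hsum ((hC u hu v).1 hv)
  have h3 : 0 ≤ r / 3 := by positivity
  rw [← add_thirds r, ENNReal.ofReal_add (add_nonneg h3 h3) h3, ENNReal.ofReal_add h3 h3]
  exact (edist_triangle4 (α := LPoint _) x (vtx G u) (vtx G v) y).trans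
    (add_le_add (add_le_add hxu huv) ((edist_comm (α := LPoint _) _ y).trans_le hyv))

end MeanLength

end GraphTop

theorem mainTheorem7_general {V : Type*} [Countable V] {G : SimpleGraph V} {ℓ : G.edgeSet → ℝ}
    (hℓ : GraphTop.LocallyBounded ℓ) (hsmall : GraphTop.HasSmallComponents ℓ) :
    GraphTop.LTopApproxMTop ℓ := by
  choose e he using hsmall.exists_isEndLimit hℓ
  let φ : GraphTop.MTop G ≃ GraphTop.LTop ℓ := Equiv.ofBijective (GraphTop.ofMTop ℓ e)
    ⟨GraphTop.injective_ofMTop hℓ he, hsmall.surjective_ofMTop hℓ he⟩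
  have hφ : Topology.IsInducing φ := hsmall.isInducing_ofMTop hℓ he
  exact ⟨(φ.toHomeomorphOfIsInducing hφ).symm, fun x => φ.symm_apply_apply (.point x)⟩

theorem mainTheorem7 {V : Type*} [Countable V] (G : SimpleGraph V) :
    (∀ w : V → ℝ, (∀ v, 0 < w v) → Summable w →
      GraphTop.LTopApproxMTop (GraphTop.meanLength G w)) ∧
    (∀ ℓ : G.edgeSet → ℝ, (∀ e, 0 < ℓ e) → Summable ℓ →
      GraphTop.LTopApproxMTop (GraphTop.meanLength G.lineGraph ℓ)) := by
  have : Countable (Sym2 V) := Quot.mk_surjective.countable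
  exact ⟨fun _ hw hs => mainTheorem7_general (GraphTop.locallyBounded_meanLength hw hs)
      (GraphTop.hasSmallComponents_meanLength (fun v => (hw v).le) hs),
    fun _ hℓ hs => mainTheorem7_general (GraphTop.locallyBounded_meanLength hℓ hs)
      (GraphTop.hasSmallComponents_meanLength (fun e => (hℓ e).le) hs)⟩
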